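/- Let $q\in\mathbb C$ with $|q|<1$. Write $(a;q)_n=\prod_{k=0}^{n-1}(1-aq^k)$, $(a;q)_\infty=\prod_{k\ge0}(1-aq^k)$, $(a,b;q)_\infty=(a;q)_\infty(b;q)_\infty$, and $\left[{n\atop j}\right]_q=\frac{(q;q)_n}{(q;q)_j(q;q)_{n-j}}$ for $0\le j\le n$, and $0$ for all other integers $j$. Put $$\mathcal R_q(u)=\sum_{n\ge0}\frac{q^{n^2}u^n}{(q;q)_n},\qquad S^*_n(x,y;q)=\sum_{k=0}^n\left[{n\atop k}\right]_q q^{k^2}x^{n-k}y^k,\qquad r_n(a,b)=\sum_{k=0}^n\left[{n\atop k}\right]_q a^{n-k}b^k ,$$ and let Garrett's polynomials be $a_0(q)=1$, $b_0(q)=0$ and, for $k\ge1$, $$a_k(q)=\sum_{i\in\mathbb Z}(-1)^iq^{i(5i-3)/2}\left[{k-1\atop \lfloor (k+1-5i)/2\rfloor}\right]_q,\qquad b_k(q)=\sum_{i\in\mathbb Z}(-1)^iq^{i(5i+1)/2}\left[{k-1\atop \lfloor (k-1-5i)/2\rfloor}\right]_q .$$ Let $b,x,y,z\in\mathbb C$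 with $|bzx|<1$. (1) For every $a\in\mathbb C$ with $|azx|<1$, both series below converge absolutely and $$\sum_{n=0}^\infty S^*_n(x,y;q)\,r_n(a,b)\frac{z^n}{(q;q)_n}=\frac1{(azx,bzx;q)_\infty}\sum_{i=0}^\infty q^{i^2}\frac{(bzx;q)_i}{(q;q)_i}(azy)^i\,\mathcal R_q(bzq^{2i}y).$$ (2) Suppose moreover that $q\ne0$ and $bzy=1$. Then for every $a\in\mathbb C$ with $|azx|<1$, both series below converge absolutely and $$\sum_{n=0}^\infty S^*_n(x,y;q)\,r_n(a,b)\frac{z^n}{(q;q)_n}=\frac1{(azx,bzx;q)_\infty}\sum_{i=0}^\infty q^{-i(i-1)}\frac{(bzx;q)_i}{(q;q)_i}\left(\frac{a_{2i}(q)}{(q,q^4;q^5)_\infty}-\frac{b_{2i}(q)}{(q^2,q^3;q^5)_\infty}\right)(azy)^i .$$ Furthermore, when $a$ is regarded as an indeterminate, one has the identity of formal power series in $\mathbb C[[a]]$ $$\sum_{n=0}^\infty S^*_n(x,y;q)\,r_n(a,b)\frac{z^n}{(q;q)_n}=\frac1{(azx,bzx;q)_\infty(q,q^4;q^5)_\infty}\sum_{i=0}^\infty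 q^{-i(i-1)}\frac{(bzx;q)_i}{(q;q)_i}a_{2i}(q)(azy)^i-\frac1{(azx,bzx;q)_\infty(q^2,q^3;q^5)_\infty}\sum_{i=0}^\infty q^{-i(i-1)}\frac{(bzx;q)_i}{(q;q)_i}b_{2i}(q)(azy)^i ,$$ where the sum over $n$ and the product $(azx;q)_\infty$ converge coefficientwise. -/

import Mathlib

open scoped PowerSeries PowerSeries.WithPiTopology

noncomputable section

/-- The finite `q`-shifted factorial `(a;q)_n = ∏_{k<n} (1 - q^k a)`. The base `q` is a complex
number and `a` lives in a commutative `ℂ`-algebra (`ℂ` itself, or `ℂ⟦X⟧`). -/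
def qPoch {R : Type*} [CommRing R] [Algebra ℂ R] (a : R) (q : ℂ) (n : ℕ) : R :=
  ∏ k ∈ Finset.range n, (1 - q ^ k • a)

/-- The infinite `q`-shifted factorial `(a;q)_∞ = ∏_{k≥0} (1 - q^k a)`. For `R = ℂ⟦X⟧` the product
is taken in the topology of coefficientwise convergence. -/
def qPochInf {R : Type*} [CommRing R] [Algebra ℂ R] [TopologicalSpace R] (a : R) (q : ℂ) : R :=
  ∏' k : ℕ, (1 - q ^ k • a)

/-- The `q`-binomial coefficient `[n; j]_q = (q;q)_n / ((q;q)_j (q;q)_{n-j})`,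
which is `0` unless `0 ≤ j ≤ n`. -/
def qBinom (q : ℂ) (n : ℕ) (j : ℤ) : ℂ :=
  if 0 ≤ j ∧ j ≤ n then
    qPoch q q n / (qPoch q q j.toNat * qPoch q q (n - j.toNat))
  else 0

/-- The Ramanujan type `q`-exponential function `R_q(z) = ∑_{n≥0} q^{n²} z^n / (q;q)_n`. -/
def ramanujanExp (q z : ℂ) : ℂ :=
  ∑' n : ℕ, q ^ (n ^ 2) * z ^ n / qPoch q q n

/-- The bivariate Stieltjes-Wigert polynomials
`S*_n(x,y;q) = ∑_{k=0}^n [n; k]_q q^{k²} x^{n-k} y^k`. -/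
def stieltjesWigert (q : ℂ) (n : ℕ) (x y : ℂ) : ℂ :=
  ∑ k ∈ Finset.range (n + 1), qBinom q n k * q ^ (k ^ 2) * x ^ (n - k) * y ^ k

/-- The generalized Rogers-Szegő polynomials `r_n(a,b) = ∑_{k=0}^n [n; k]_q a^{n-k} b^k`,
with `a`, `b` in a commutative `ℂ`-algebra. -/
def rogersSzego {R : Type*} [CommRing R] [Algebra ℂ R] (q : ℂ) (n : ℕ) (a b : R) : R :=
  ∑ k ∈ Finset.range (n + 1), qBinom q n k • (a ^ (n - k) * b ^ k)

/-- Garrett's polynomials `a_k(q)`: `a_0 = 1` and, for `k ≥ 1`,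
`a_k(q) = ∑_{i∈ℤ} (-1)^i q^{i(5i-3)/2} [k-1; ⌊(k+1-5i)/2⌋]_q` (finitely many nonzero terms).
The integer division in the exponent is exact, and in the lower index it is the floor. -/
def garrettA (q : ℂ) (k : ℕ) : ℂ :=
  if k = 0 then 1 else
    ∑ᶠ i : ℤ, (-1 : ℂ) ^ i * q ^ (i * (5 * i - 3) / 2) *
      qBinom q (k - 1) (((k : ℤ) + 1 - 5 * i) / 2)

/-- Garrett's polynomials `b_k(q)`: `b_0 = 0` and, for `k ≥ 1`,
`b_k(q) = ∑_{i∈ℤ} (-1)^i q^{i(5i+1)/2} [k-1; ⌊(k-1-5i)/2⌋]_q` (finitely many nonzero terms). -/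
def garrettB (q : ℂ) (k : ℕ) : ℂ :=
  if k = 0 then 0 else
    ∑ᶠ i : ℤ, (-1 : ℂ) ^ i * q ^ (i * (5 * i + 1) / 2) *
      qBinom q (k - 1) (((k : ℤ) - 1 - 5 * i) / 2)

end

/-! Put v = zy, w = zx. Then S*_n z^n/(q;q)_n is the Cauchy product of q^{k²}v^k/(q;q)_k and
w^m/(q;q)_m, so the coefficient of a^d in the generating function is a double series over (k, m)
with weight [k+m; d] b^{k+m-d}. The q-Vandermonde convolution (`qBinom_add_mul_pow`) splits this
weight into products indexed by i + j = d. For each of them the k-sum is a value of R_q at bv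
q^{2i}, and the m-sum is 1/(b q^i w;q)_∞ by Euler. Since (bw;q)_∞ = (bw;q)_i (q^i bw;q)_∞, the
result is the convolution of `rightCoeff` with the coefficients of 1/(aw;q)_∞ (`hasSum_coeff`). This
settles the formal identity coefficientwise; for complex a, absolute summability over (n, d) permits
the interchange.

If bv = 1, only the values R_q(q^{2i}) are needed. The relation R_q(u) = R_q(qu) + qu R_q(q²u) and
Garrett's recurrence c_{k+2} = c_{k+1} + q^k c_k express R_q(q^m) through R_q(1) and R_q(q)
(`pow_choose_mul_ramanujanExp`). These two are the limits of b_k and a_k, which the Jacobi triple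
product in base q^5 evaluates; this proves the Rogers–Ramanujan identities on the way. -/

open Filter Topology

/-! ### Finite q-shifted factorials -/

section Basics

variable {R : Type*} [CommRing R] [Algebra ℂ R]

@[simp] lemma qPoch_zero (a : R) (q : ℂ) : qPoch a q 0 = 1 := by simp [qPoch]

lemma qPoch_succ (a : R) (q : ℂ) (n : ℕ) : qPoch a q (n + 1) = qPoch a q n * (1 - q ^ n • a) :=
  Finset.prod_range_succ _ _

lemma qPoch_add (a : R) (q : ℂ) (i k : ℕ) :
    qPoch a q (i + k) = qPoch a q i * qPoch (q ^ i • a) q k := by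
  simp only [qPoch, Finset.prod_range_add, pow_add, smul_smul, mul_comm]

lemma qPoch_self_succ (q : ℂ) (n : ℕ) :
    qPoch q q (n + 1) = qPoch q q n * (1 - q ^ (n + 1)) := by
  rw [qPoch_succ, smul_eq_mul, pow_succ]

lemma one_sub_pow_ne_zero {q : ℂ} (hq : ‖q‖ < 1) (n : ℕ) : 1 - q ^ (n + 1) ≠ 0 := by
  intro h
  have h1 : ‖q ^ (n + 1)‖ < 1 := by
    rw [norm_pow]; exact pow_lt_one₀ (norm_nonneg _) hq (by omega)
  rw [← sub_eq_zero.mp h] at h1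
  simp at h1

lemma qPoch_self_ne_zero {q : ℂ} (hq : ‖q‖ < 1) (n : ℕ) : qPoch q q n ≠ 0 := by
  induction n with
  | zero => simp
  | succ n ih => rw [qPoch_self_succ]; exact mul_ne_zero ih (one_sub_pow_ne_zero hq n)

end Basics

/-! ### q-binomial coefficients: Pascal rules and q-Vandermonde -/

section Binomial

lemma qBinom_of_neg (q : ℂ) (n : ℕ) {j : ℤ} (h : j < 0) : qBinom q n j = 0 :=
  if_neg (by omega)

lemma qBinom_of_lt (q : ℂ) {n : ℕ} {j : ℤ} (h : (n : ℤ) < j) : qBinom q n j = 0 :=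
  if_neg (by omega)

lemma qBinom_add (q : ℂ) (j l : ℕ) :
    qBinom q (j + l) j = qPoch q q (j + l) / (qPoch q q j * qPoch q q l) := by
  rw [qBinom, if_pos (by omega)]; simp

lemma qBinom_zero_right {q : ℂ} (hq : ‖q‖ < 1) (n : ℕ) : qBinom q n 0 = 1 := by
  have := qBinom_add q 0 n
  simpa [qPoch_self_ne_zero hq] using this

lemma qBinom_self {q : ℂ} (hq : ‖q‖ < 1) (n : ℕ) : qBinom q n n = 1 := by
  have := qBinom_add q n 0
  simpa [qPoch_self_ne_zero hq] using this

lemma qBinom_succ {q : ℂ} (hq : ‖q‖ < 1) (n : ℕ) (j : ℤ) :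
    qBinom q (n + 1) j = qBinom q n (j - 1) + q ^ j * qBinom q n j := by
  rcases lt_or_ge j 0 with h | h
  · rw [qBinom_of_neg _ _ h, qBinom_of_neg _ _ h, qBinom_of_neg _ _ (by omega)]; simp
  rcases lt_or_ge ((n : ℤ) + 1) j with h' | h'
  · rw [qBinom_of_lt _ (by push_cast; omega), qBinom_of_lt _ (by omega),
      qBinom_of_lt _ (by omega)]; simp
  lift j to ℕ using h
  rcases j with _ | j
  · rw [qBinom_of_neg q n (by simp)]; simp [qBinom_zero_right hq]
  obtain ⟨l, rfl⟩ : ∃ l, n = j + l := ⟨n - j, by omega⟩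
  rw [show ((j + 1 : ℕ) : ℤ) - 1 = j by push_cast; ring, qBinom_add]
  rcases l with _ | l
  · rw [qBinom_of_lt q (n := j + 0) (by push_cast; omega)]
    have := qBinom_self hq (j + 1)
    simp [qPoch_self_ne_zero hq] at this ⊢
    exact this
  · rw [show j + (l + 1) = (j + 1) + l by ring, qBinom_add,
      show (j + 1) + l + 1 = (j + 1) + (l + 1) by ring, qBinom_add, zpow_natCast,
      show (j + 1) + (l + 1) = (j + 1 + l) + 1 by ring, qPoch_self_succ q (j + 1 + l),
      qPoch_self_succ q j, qPoch_self_succ q l]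
    have h1 := qPoch_self_ne_zero hq j
    have h2 := qPoch_self_ne_zero hq l
    have h3 := one_sub_pow_ne_zero hq j
    have h4 := one_sub_pow_ne_zero hq l
    field_simp
    ring

lemma qBinom_symm (q : ℂ) (n : ℕ) (j : ℤ) : qBinom q n (n - j) = qBinom q n j := by
  rcases lt_or_ge j 0 with h | h
  · rw [qBinom_of_neg _ _ h, qBinom_of_lt _ (by omega)]
  rcases lt_or_ge (n : ℤ) j with h' | h'
  · rw [qBinom_of_lt _ h', qBinom_of_neg _ _ (by omega)]
  lift j to ℕ using h
  obtain ⟨l, rfl⟩ : ∃ l, n = j + l := ⟨n - j, by omega⟩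
  rw [show ((j + l : ℕ) : ℤ) - j = l by push_cast; ring, qBinom_add, add_comm j l, qBinom_add,
    mul_comm]

lemma qBinom_succ' {q : ℂ} (hq : ‖q‖ < 1) (n : ℕ) (j : ℤ) :
    qBinom q (n + 1) j = qBinom q n j + q ^ ((n : ℤ) + 1 - j) * qBinom q n (j - 1) := by
  rw [← qBinom_symm, qBinom_succ hq, ← qBinom_symm q n j, ← qBinom_symm q n (j - 1),
    show ((n + 1 : ℕ) : ℤ) - j - 1 = n - j by push_cast; ring,
    show ((n + 1 : ℕ) : ℤ) - j = n - (j - 1) by push_cast; ring,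
    show (n : ℤ) + 1 - j = n - (j - 1) by ring]

/-- The `q`-Vandermonde convolution. -/
lemma qBinom_add_left {q : ℂ} (hq : ‖q‖ < 1) (k m d : ℕ) :
    qBinom q (k + m) d = ∑ ij ∈ Finset.HasAntidiagonal.antidiagonal d,
      qBinom q k ij.1 * qBinom q m ij.2 * q ^ (ij.1 * (m - ij.2)) := by
  induction m generalizing d with
  | zero =>
    rw [Finset.sum_eq_single (d, 0)]
    · simp [qBinom_zero_right hq]
    · rintro ⟨i, j⟩ hij hne
      rcases j with _ | j
      · simp at hij hne; omega
      · simp only []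
        rw [qBinom_of_lt q (n := 0) (by push_cast; omega)]; simp
    · simp
  | succ m ih =>
    rw [← add_assoc, qBinom_succ hq]
    rcases d with _ | d
    · rw [qBinom_of_neg _ _ (by simp)]
      simp [qBinom_zero_right hq]
    · rw [show ((d + 1 : ℕ) : ℤ) - 1 = d by push_cast; ring, ih, ih]
      rw [Finset.Nat.sum_antidiagonal_succ', Finset.Nat.sum_antidiagonal_succ', mul_add,
        Finset.mul_sum, add_left_comm, ← Finset.sum_add_distrib]
      simp only [Nat.cast_zero, qBinom_zero_right hq, zpow_natCast]
      refine congrArg₂ (· + ·) ?_ (Finset.sum_congr rfl fun ij hij => ?_)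
      · simp only [Nat.sub_zero]; ring
      · rw [qBinom_succ hq m, show ((ij.2 + 1 : ℕ) : ℤ) - 1 = ij.2 by push_cast; ring,
          show m + 1 - (ij.2 + 1) = m - ij.2 by omega, zpow_natCast]
        -- Where the subtraction in the exponent truncates, the q-binomial coefficient vanishes.
        rcases Nat.lt_or_ge m (ij.2 + 1) with h | h
        · rw [qBinom_of_lt q (n := m) (j := ((ij.2 + 1 : ℕ) : ℤ)) (by omega)]; ring
        · have hij' : ij.1 + ij.2 = d := by simpa using hij
          obtain ⟨r, rfl⟩ := Nat.exists_eq_add_of_le h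
          rw [show ij.2 + 1 + r - ij.2 = r + 1 by omega,
            show ij.2 + 1 + r - (ij.2 + 1) = r by omega, ← hij']
          ring

end Binomial

/-! ### Infinite products, limits of q-binomials, Euler's expansion -/

section InfiniteProduct

lemma tendsto_qPoch_of_multipliable {R : Type*} [CommRing R] [Algebra ℂ R] [TopologicalSpace R]
    [T2Space R] {a : R} {q : ℂ} (h : Multipliable fun k : ℕ => 1 - q ^ k • a) :
    Tendsto (qPoch a q) atTop (𝓝 (qPochInf a q)) :=
  h.tendsto_prod_tprod_nat

variable {q : ℂ}

lemma summable_norm_pow_smul (hq : ‖q‖ < 1) (a : ℂ) : Summable fun k : ℕ => ‖-(q ^ k • a)‖ := by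
  simp only [norm_neg, norm_smul, norm_pow]
  exact (summable_geometric_of_lt_one (norm_nonneg _) hq).mul_right _

lemma tendsto_qPoch (hq : ‖q‖ < 1) (a : ℂ) :
    Tendsto (qPoch a q) atTop (𝓝 (qPochInf a q)) := by
  apply tendsto_qPoch_of_multipliable
  simp only [sub_eq_add_neg]
  exact multipliable_one_add_of_summable (summable_norm_pow_smul hq a)

lemma norm_pow_mul_lt_one (hq : ‖q‖ < 1) {a : ℂ} (ha : ‖a‖ < 1) (k : ℕ) : ‖q ^ k * a‖ < 1 := by
  rw [norm_mul, norm_pow]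
  exact mul_lt_one_of_nonneg_of_lt_one_right (pow_le_one₀ (norm_nonneg _) hq.le) (norm_nonneg _) ha

lemma qPochInf_ne_zero (hq : ‖q‖ < 1) {a : ℂ} (ha : ‖a‖ < 1) : qPochInf a q ≠ 0 := by
  simp only [qPochInf, sub_eq_add_neg]
  refine tprod_one_add_ne_zero_of_summable (fun k h => ?_) (summable_norm_pow_smul hq a)
  have h1 := norm_pow_mul_lt_one hq ha k
  rw [← sub_eq_add_neg, smul_eq_mul] at h
  rw [← sub_eq_zero.mp h] at h1
  simp at h1

lemma qPochInf_eq_qPoch_mul (hq : ‖q‖ < 1) (a : ℂ) (i : ℕ) :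
    qPochInf a q = qPoch a q i * qPochInf (q ^ i * a) q := by
  refine tendsto_nhds_unique ((tendsto_qPoch hq a).comp (tendsto_add_atTop_nat i)) ?_
  have := (tendsto_qPoch hq (q ^ i * a)).const_mul (qPoch a q i)
  refine this.congr fun k => ?_
  simp only [Function.comp]
  rw [add_comm, qPoch_add, smul_eq_mul]

lemma exists_norm_qPoch_self_le (hq : ‖q‖ < 1) :
    ∃ C : ℝ, 0 < C ∧ (∀ n, ‖qPoch q q n‖ ≤ C) ∧ ∀ n, ‖(qPoch q q n)⁻¹‖ ≤ C := by
  have h1 := (tendsto_qPoch hq q).norm.bddAbove_range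
  have h2 := ((tendsto_qPoch hq q).inv₀ (qPochInf_ne_zero hq hq)).norm.bddAbove_range
  obtain ⟨A, hA⟩ := h1
  obtain ⟨B, hB⟩ := h2
  refine ⟨max 1 (max A B), by positivity, fun n => ?_, fun n => ?_⟩
  · exact (hA ⟨n, rfl⟩).trans (by simp)
  · exact (hB ⟨n, rfl⟩).trans (by simp)

lemma exists_norm_qBinom_le (hq : ‖q‖ < 1) : ∃ C : ℝ, 0 < C ∧ ∀ n j, ‖qBinom q n j‖ ≤ C := by
  obtain ⟨C, hC, h1, h2⟩ := exists_norm_qPoch_self_le hq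
  refine ⟨C * (C * C), by positivity, fun n j => ?_⟩
  unfold qBinom
  split_ifs
  · rw [div_eq_mul_inv, mul_inv, norm_mul, norm_mul]
    gcongr <;> first | apply h1 | apply h2
  · simp; positivity

lemma tendsto_qBinom (hq : ‖q‖ < 1) {ι : Type*} {l : Filter ι} {n : ι → ℕ} {j : ι → ℤ}
    (hj : Tendsto j l atTop) (hnj : Tendsto (fun k => (n k : ℤ) - j k) l atTop) :
    Tendsto (fun k => qBinom q (n k) (j k)) l (𝓝 (1 / qPochInf q q)) := by
  have toNat : Tendsto Int.toNat atTop atTop :=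
    tendsto_atTop.mpr fun b => (eventually_ge_atTop (b : ℤ)).mono fun x hx => by omega
  have e1 := (tendsto_qPoch hq q).comp (toNat.comp hj)
  have e2 := (tendsto_qPoch hq q).comp (toNat.comp hnj)
  have hn : Tendsto n l atTop := by
    have := toNat.comp (hj.atTop_add_atTop hnj)
    refine this.congr fun k => ?_
    simp
  have e3 := (tendsto_qPoch hq q).comp hn
  have hE := qPochInf_ne_zero hq hq
  have key := e3.div (e1.mul e2) (mul_ne_zero hE hE)
  rw [show qPochInf q q / (qPochInf q q * qPochInf q q) = 1 / qPochInf q q by field_simp] at key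
  refine key.congr' ?_
  filter_upwards [hj.eventually_ge_atTop 0, hnj.eventually_ge_atTop 0] with k h1 h2
  rw [qBinom, if_pos (by omega)]
  simp only [Function.comp, Pi.div_apply]
  congr 4
  omega

/-- Dominated convergence with majorant ‖c n‖. It evaluates the limit of f(q^N a) after a
q-difference equation for f has been iterated N times. -/
lemma tendsto_tsum_pow_mul (hq : ‖q‖ < 1) {c : ℕ → ℂ} (hc : Summable fun n => ‖c n‖) :
    Tendsto (fun N : ℕ => ∑' n, c n * (q ^ N) ^ n) atTop (𝓝 (c 0)) := by
  rw [show c 0 = ∑' n, (if n = 0 then c 0 else 0) by simp]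
  refine tendsto_tsum_of_dominated_convergence hc (fun n => ?_) (Eventually.of_forall fun N n => ?_)
  · rcases n with _ | n
    · simp
    · have h1 : Tendsto (fun N : ℕ => q ^ N) atTop (𝓝 0) := tendsto_pow_atTop_nhds_zero_of_norm_lt_one hq
      simpa using (h1.pow (n + 1)).const_mul (c (n + 1))
  · rw [norm_mul, norm_pow, norm_pow]
    exact mul_le_of_le_one_right (norm_nonneg _)
      (pow_le_one₀ (by positivity) (pow_le_one₀ (norm_nonneg _) hq.le))

lemma summable_norm_pow_div_qPoch (hq : ‖q‖ < 1) {a : ℂ} (ha : ‖a‖ < 1) :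
    Summable fun n : ℕ => ‖a ^ n / qPoch q q n‖ := by
  obtain ⟨C, hC, -, h2⟩ := exists_norm_qPoch_self_le hq
  refine Summable.of_nonneg_of_le (fun _ => norm_nonneg _) (fun n => ?_)
    ((summable_geometric_of_lt_one (norm_nonneg _) ha).mul_right C)
  rw [div_eq_mul_inv, norm_mul, norm_pow]
  gcongr
  exact h2 n

/-- In f(a) - f(qa) the factor 1 - q^{n+1} cancels the last factor of (q;q)_{n+1}, which leaves a
f(a). -/
lemma tsum_pow_div_qPoch_shift (hq : ‖q‖ < 1) {a : ℂ} (ha : ‖a‖ < 1) :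
    (1 - a) * ∑' n : ℕ, a ^ n / qPoch q q n = ∑' n : ℕ, (q * a) ^ n / qPoch q q n := by
  have hs := (summable_norm_pow_div_qPoch hq ha).of_norm
  have hqa : ‖q * a‖ < 1 := by simpa using norm_pow_mul_lt_one hq ha 1
  have hs' := (summable_norm_pow_div_qPoch hq hqa).of_norm
  rw [sub_mul, one_mul, sub_eq_iff_eq_add, ← sub_eq_iff_eq_add', ← hs.tsum_sub hs',
    (hs.sub hs').tsum_eq_zero_add, ← tsum_mul_left]
  simp only [pow_zero, sub_self, zero_add]
  refine tsum_congr fun n => ?_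
  have := one_sub_pow_ne_zero hq n
  have := qPoch_self_ne_zero hq n
  rw [qPoch_self_succ]
  field_simp
  ring

/-- Euler's expansion of `1 / (a;q)_∞`. -/
lemma hasSum_pow_div_qPoch (hq : ‖q‖ < 1) {a : ℂ} (ha : ‖a‖ < 1) :
    HasSum (fun n : ℕ => a ^ n / qPoch q q n) (1 / qPochInf a q) := by
  have hsn := summable_norm_pow_div_qPoch hq ha
  have key (N : ℕ) : qPoch a q N * ∑' n : ℕ, a ^ n / qPoch q q n
      = ∑' n : ℕ, a ^ n / qPoch q q n * (q ^ N) ^ n := by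
    have : ∀ n : ℕ, a ^ n / qPoch q q n * (q ^ N) ^ n = (q ^ N * a) ^ n / qPoch q q n :=
      fun n => by ring
    simp only [this]
    induction N with
    | zero => simp
    | succ N ih =>
      rw [qPoch_succ, mul_right_comm, ih fun n => by ring, smul_eq_mul, mul_comm,
        tsum_pow_div_qPoch_shift hq (norm_pow_mul_lt_one hq ha N)]
      simp only [pow_succ', mul_assoc]
  have h1 := (tendsto_qPoch hq a).mul_const (∑' n : ℕ, a ^ n / qPoch q q n)
  have h2 := (tendsto_tsum_pow_mul hq hsn).congr fun N => (key N).symm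
  have h3 := tendsto_nhds_unique h1 h2
  rw [← eq_div_of_mul_eq (qPochInf_ne_zero hq ha) ((mul_comm _ _).trans (h3.trans (by simp)))]
  exact hsn.of_norm.hasSum

end InfiniteProduct

/-! ### Euler's expansion in formal power series -/

section PowerSeries

open PowerSeries

lemma multipliable_one_sub_smul_X {q : ℂ} (hq : ‖q‖ < 1) (c : ℂ) :
    Multipliable fun k : ℕ => (1 : ℂ⟦X⟧) - q ^ k • (c • (X : ℂ⟦X⟧)) := by
  have h : ∀ k : ℕ, (1 : ℂ⟦X⟧) - q ^ k • (c • (X : ℂ⟦X⟧))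
      = 1 + PowerSeries.C (-(q ^ k • c)) * X := fun k => by
    rw [map_neg, neg_mul, ← sub_eq_add_neg, smul_smul, smul_eq_C_mul]; rfl
  simp only [h]
  apply multipliable_one_add_of_summable_prod
  rw [WithPiTopology.summable_iff_summable_coeff]
  intro d
  have hs := summable_finsetProd_of_summable_norm (summable_norm_pow_smul hq c)
  refine Summable.of_norm_bounded hs.norm fun s => ?_
  -- The product over s is a constant times X^|s|, so each coefficient is dominated by the
  -- absolutely summable scalar products.
  rw [Finset.prod_mul_distrib, Finset.prod_const, ← map_prod, coeff_C_mul, coeff_X_pow]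
  split_ifs
  · simp
  · simpa using Finset.prod_nonneg fun _ _ => by positivity

lemma one_sub_smul_X_mul_mk {q : ℂ} (hq : ‖q‖ < 1) (c : ℂ) :
    (1 - c • (X : ℂ⟦X⟧)) * PowerSeries.mk (fun n => c ^ n / qPoch q q n)
      = PowerSeries.mk (fun n => (q * c) ^ n / qPoch q q n) := by
  ext n
  rw [sub_mul, one_mul, smul_mul_assoc, map_sub, coeff_smul]
  rcases n with _ | n
  · simp
  · rw [coeff_succ_X_mul, coeff_mk, coeff_mk, coeff_mk, qPoch_self_succ]
    have := one_sub_pow_ne_zero hq n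
    have := qPoch_self_ne_zero hq n
    simp only [smul_eq_mul]
    field_simp
    ring

lemma inv_qPochInf_smul_X {q : ℂ} (hq : ‖q‖ < 1) (c : ℂ) :
    (qPochInf (c • (X : ℂ⟦X⟧)) q)⁻¹ = PowerSeries.mk fun n => c ^ n / qPoch q q n := by
  have key (N : ℕ) : qPoch (c • (X : ℂ⟦X⟧)) q N * PowerSeries.mk (fun n => c ^ n / qPoch q q n)
      = PowerSeries.mk (fun n => (q ^ N * c) ^ n / qPoch q q n) := by
    induction N with
    | zero => simp
    | succ N ih =>
      rw [qPoch_succ, mul_right_comm, ih, smul_smul, mul_comm, one_sub_smul_X_mul_mk hq]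
      simp only [pow_succ', mul_assoc]
  have h1 := (tendsto_qPoch_of_multipliable (multipliable_one_sub_smul_X hq c)).mul_const
    (PowerSeries.mk (fun n => c ^ n / qPoch q q n))
  have h2 : Tendsto (fun N : ℕ => PowerSeries.mk (fun n => (q ^ N * c) ^ n / qPoch q q n)) atTop
      (𝓝 1) := by
    rw [WithPiTopology.tendsto_iff_coeff_tendsto]
    intro d
    simp only [coeff_mk, coeff_one]
    rcases d with _ | d
    · simp
    · have h1 : Tendsto (fun N : ℕ => q ^ N) atTop (𝓝 0) :=
        tendsto_pow_atTop_nhds_zero_of_norm_lt_one hq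
      simpa using ((h1.mul_const c).pow (d + 1)).div_const (qPoch q q (d + 1))
  have h3 := tendsto_nhds_unique h1 (h2.congr fun N => (key N).symm)
  -- The inverse in `ℂ⟦X⟧` is a default 0 when the constant coefficient vanishes; `h3` excludes
  -- this.
  have h4 : constantCoeff (qPochInf (c • (X : ℂ⟦X⟧)) q) ≠ 0 := fun h => by
    have := congrArg (constantCoeff (R := ℂ)) h3
    rw [map_mul, h] at this
    simp at this
  exact (PowerSeries.inv_eq_iff_mul_eq_one h4).mpr ((mul_comm _ _).trans h3)

end PowerSeries

/-! ### The generating function, for complex and for indeterminate a -/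

section GeneratingFunction

variable {q : ℂ}

lemma summable_pow_sq_mul_pow {r : ℝ} (hr0 : 0 ≤ r) (hr : r < 1) (u : ℝ) :
    Summable fun n : ℕ => r ^ (n ^ 2) * u ^ n := by
  have h : Tendsto (fun n : ℕ => r ^ n * |u|) atTop (𝓝 0) := by
    simpa using (tendsto_pow_atTop_nhds_zero_of_lt_one hr0 hr).mul_const |u|
  -- The term is (r^n u)^n, and r^n |u| eventually stays below 1/2.
  refine Summable.of_norm_bounded_eventually_nat
    (summable_geometric_of_lt_one (by norm_num) (by norm_num : (1 / 2 : ℝ) < 1)) ?_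
  filter_upwards [h.eventually_le_const (by norm_num : (0 : ℝ) < 1 / 2)] with n hn
  rw [norm_mul, norm_pow, norm_pow, Real.norm_eq_abs, Real.norm_eq_abs, abs_of_nonneg hr0, sq,
    pow_mul, ← mul_pow]
  exact pow_le_pow_left₀ (by positivity) hn n

lemma summable_norm_ramanujanExp (hq : ‖q‖ < 1) (u : ℂ) :
    Summable fun n : ℕ => ‖q ^ (n ^ 2) * u ^ n / qPoch q q n‖ := by
  obtain ⟨C, hC, -, h2⟩ := exists_norm_qPoch_self_le hq
  refine Summable.of_nonneg_of_le (fun _ => norm_nonneg _) (fun n => ?_)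
    ((summable_pow_sq_mul_pow (norm_nonneg q) hq ‖u‖).mul_right C)
  rw [div_eq_mul_inv, norm_mul, norm_mul, norm_pow, norm_pow]
  gcongr
  exact h2 n

lemma hasSum_ramanujanExp (hq : ‖q‖ < 1) (u : ℂ) :
    HasSum (fun n : ℕ => q ^ (n ^ 2) * u ^ n / qPoch q q n) (ramanujanExp q u) :=
  (summable_norm_ramanujanExp hq u).of_norm.hasSum

lemma tendsto_ramanujanExp_mul_pow (hq : ‖q‖ < 1) (u : ℂ) :
    Tendsto (fun N : ℕ => ramanujanExp q (u * q ^ N)) atTop (𝓝 1) := by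
  have := tendsto_tsum_pow_mul hq (summable_norm_ramanujanExp hq u)
  simp only [ne_eq, OfNat.ofNat_ne_zero, not_false_eq_true, zero_pow, pow_zero, mul_one, qPoch_zero,
    div_one] at this
  refine this.congr fun N => tsum_congr fun n => ?_
  rw [mul_pow]
  ring

lemma hasSum_mul_prod {f g : ℕ → ℂ} {s t : ℂ} (hf : HasSum f s) (hg : HasSum g t) :
    HasSum (fun p : ℕ × ℕ => f p.1 * g p.2) (s * t) :=
  hf.mul hg (summable_mul_of_summable_norm (summable_norm_iff.mpr hf.summable)
    (summable_norm_iff.mpr hg.summable))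

lemma hasSum_sum_antidiagonal {f : ℕ × ℕ → ℂ} {s : ℂ} (h : HasSum f s) :
    HasSum (fun n => ∑ p ∈ Finset.HasAntidiagonal.antidiagonal n, f p) s := by
  have h1 := (Finset.HasAntidiagonal.sigmaAntidiagonalEquivProd (A := ℕ)).hasSum_iff.mpr h
  refine h1.sigma fun n => ?_
  have := hasSum_fintype fun p : Finset.HasAntidiagonal.antidiagonal n => f p
  rwa [Finset.sum_coe_sort] at this

lemma stieltjesWigert_mul_pow_div (hq : ‖q‖ < 1) (n : ℕ) (x y z : ℂ) :
    stieltjesWigert q n x y * z ^ n / qPoch q q n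
      = ∑ p ∈ Finset.HasAntidiagonal.antidiagonal n,
          q ^ (p.1 ^ 2) * (z * y) ^ p.1 / qPoch q q p.1 * ((z * x) ^ p.2 / qPoch q q p.2) := by
  rw [Finset.Nat.sum_antidiagonal_eq_sum_range_succ_mk, stieltjesWigert, Finset.sum_mul,
    Finset.sum_div]
  refine Finset.sum_congr rfl fun k hk => ?_
  obtain ⟨l, rfl⟩ := Nat.exists_eq_add_of_le (Nat.lt_succ_iff.mp (Finset.mem_range.mp hk))
  have h1 := qPoch_self_ne_zero hq k
  have h2 := qPoch_self_ne_zero hq l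
  have h3 := qPoch_self_ne_zero hq (k + l)
  rw [qBinom_add, Nat.add_sub_cancel_left, pow_add, mul_pow, mul_pow]
  field_simp

/-- Only k = i + n contributes, and (i+n)² = i² + 2in + n² produces the argument shift q^{2i}. -/
lemma hasSum_ramanujanExp_qBinom (hq : ‖q‖ < 1) (b v : ℂ) (i : ℕ) :
    HasSum (fun k : ℕ => q ^ (k ^ 2) * v ^ k / qPoch q q k * (qBinom q k i * b ^ (k - i)))
      (q ^ (i ^ 2) * v ^ i / qPoch q q i * ramanujanExp q (b * v * q ^ (2 * i))) := by
  rw [← (add_right_injective i).hasSum_iff]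
  · refine ((hasSum_ramanujanExp hq (b * v * q ^ (2 * i))).mul_left _).congr_fun fun n => ?_
    have h1 := qPoch_self_ne_zero hq i
    have h2 := qPoch_self_ne_zero hq n
    have h3 := qPoch_self_ne_zero hq (i + n)
    simp only [Function.comp]
    rw [qBinom_add, Nat.add_sub_cancel_left]
    field_simp
    ring
  · intro k hk
    have : k < i := by
      by_contra h
      exact hk ⟨k - i, by simp only []; omega⟩
    rw [qBinom_of_lt q (by omega)]
    simp

lemma hasSum_pow_div_qPoch_qBinom (hq : ‖q‖ < 1) {c w : ℂ} (hc : ‖c * w‖ < 1) (j : ℕ) :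
    HasSum (fun m : ℕ => w ^ m / qPoch q q m * (qBinom q m j * c ^ (m - j)))
      (w ^ j / qPoch q q j * (1 / qPochInf (c * w) q)) := by
  rw [← (add_right_injective j).hasSum_iff]
  · refine ((hasSum_pow_div_qPoch hq hc).mul_left _).congr_fun fun n => ?_
    have h1 := qPoch_self_ne_zero hq j
    have h2 := qPoch_self_ne_zero hq n
    have h3 := qPoch_self_ne_zero hq (j + n)
    simp only [Function.comp]
    rw [qBinom_add, Nat.add_sub_cancel_left]
    field_simp
    ring
  · intro k hk
    have : k < j := by
      by_contra h
      exact hk ⟨k - j, by simp only []; omega⟩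
    rw [qBinom_of_lt q (by omega)]
    simp

/-- Absorbing the Vandermonde factor q^{i(m-j)} into b^{m-j} makes one factor depend on k alone and
the other on m alone, so the double series factorises. -/
lemma qBinom_add_mul_pow (hq : ‖q‖ < 1) (b : ℂ) (k m d : ℕ) :
    qBinom q (k + m) d * b ^ (k + m - d) = ∑ ij ∈ Finset.HasAntidiagonal.antidiagonal d,
      qBinom q k ij.1 * b ^ (k - ij.1) * (qBinom q m ij.2 * (b * q ^ ij.1) ^ (m - ij.2)) := by
  rw [qBinom_add_left hq, Finset.sum_mul]
  refine Finset.sum_congr rfl fun ij hij => ?_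
  rcases lt_or_ge k ij.1 with h | h
  · rw [qBinom_of_lt q (n := k) (by omega)]; ring
  rcases lt_or_ge m ij.2 with h' | h'
  · rw [qBinom_of_lt q (n := m) (by omega)]; ring
  have hij' : ij.1 + ij.2 = d := by simpa using hij
  rw [show k + m - d = (k - ij.1) + (m - ij.2) by omega, pow_add, mul_pow, pow_mul]
  ring

/-- The coefficient of `a ^ i` in the series on the right-hand side. -/
noncomputable def rightCoeff (q b v w : ℂ) (i : ℕ) : ℂ :=
  1 / qPochInf (b * w) q *
    (q ^ (i ^ 2) * qPoch (b * w) q i / qPoch q q i * v ^ i * ramanujanExp q (b * v * q ^ (2 * i)))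

lemma rightCoeff_mul (hq : ‖q‖ < 1) {b w : ℂ} (hb : ‖b * w‖ < 1) (v s : ℂ) (i : ℕ) :
    q ^ (i ^ 2) * v ^ i / qPoch q q i * ramanujanExp q (b * v * q ^ (2 * i)) *
      (s * (1 / qPochInf (b * q ^ i * w) q)) = rightCoeff q b v w i * s := by
  have e := qPochInf_eq_qPoch_mul hq (b * w) i
  rw [show b * q ^ i * w = q ^ i * (b * w) by ring]
  have e1 := qPochInf_ne_zero hq hb
  have e2 := qPochInf_ne_zero hq (norm_pow_mul_lt_one hq hb i)
  have e3 : qPoch (b * w) q i ≠ 0 := left_ne_zero_of_mul (e ▸ e1)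
  have e4 := qPoch_self_ne_zero hq i
  rw [rightCoeff, e]
  generalize qPochInf (q ^ i * (b * w)) q = P at *
  generalize qPoch (b * w) q i = S at *
  generalize ramanujanExp q (b * v * q ^ (2 * i)) = T at *
  field_simp

/-- The coefficient of `a ^ d` in the generating function. -/
lemma hasSum_coeff (hq : ‖q‖ < 1) {b x y z : ℂ} (hb : ‖b * (z * x)‖ < 1) (d : ℕ) :
    HasSum (fun n : ℕ => stieltjesWigert q n x y * z ^ n / qPoch q q n *
        (qBinom q n d * b ^ (n - d)))
      (∑ ij ∈ Finset.HasAntidiagonal.antidiagonal d,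
        rightCoeff q b (z * y) (z * x) ij.1 * ((z * x) ^ ij.2 / qPoch q q ij.2)) := by
  set v := z * y
  set w := z * x
  have key : HasSum (fun p : ℕ × ℕ => q ^ (p.1 ^ 2) * v ^ p.1 / qPoch q q p.1 *
      (w ^ p.2 / qPoch q q p.2) * (qBinom q (p.1 + p.2) d * b ^ (p.1 + p.2 - d)))
      (∑ ij ∈ Finset.HasAntidiagonal.antidiagonal d,
        rightCoeff q b v w ij.1 * (w ^ ij.2 / qPoch q q ij.2)) := by
    simp only [qBinom_add_mul_pow hq, Finset.mul_sum]
    refine hasSum_sum fun ij _ => ?_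
    have hb' : ‖b * q ^ ij.1 * w‖ < 1 := by
      rw [show b * q ^ ij.1 * w = q ^ ij.1 * (b * w) by ring]
      exact norm_pow_mul_lt_one hq hb _
    have h1 := hasSum_ramanujanExp_qBinom hq b v ij.1
    have h2 := hasSum_pow_div_qPoch_qBinom hq hb' ij.2
    have h3 := hasSum_mul_prod h1 h2
    rw [← rightCoeff_mul hq hb]
    exact h3.congr_fun fun p => by ring
  refine (hasSum_sum_antidiagonal key).congr_fun fun n => ?_
  rw [stieltjesWigert_mul_pow_div hq, Finset.sum_mul]
  refine Finset.sum_congr rfl fun p hp => ?_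
  rw [show p.1 + p.2 = n by simpa using hp]

lemma rogersSzego_eq_sum {R : Type*} [CommRing R] [Algebra ℂ R] (n : ℕ) (a b : R) :
    rogersSzego q n a b = ∑ d ∈ Finset.range (n + 1), qBinom q n d • (a ^ d * b ^ (n - d)) := by
  rw [rogersSzego, ← Finset.sum_range_reflect]
  refine Finset.sum_congr rfl fun d hd => ?_
  have hd' : d ≤ n := Nat.lt_succ_iff.mp (Finset.mem_range.mp hd)
  rw [show n + 1 - 1 - d = n - d by omega, show n - (n - d) = d by omega, Nat.cast_sub hd',
    qBinom_symm]

/-- All factors but q^{i²} (va)^i are bounded, R_q(bv q^{2i}) because it tends to 1; hence no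
restriction on a. -/
lemma summable_norm_rightCoeff (hq : ‖q‖ < 1) (b v w a : ℂ) :
    Summable fun i : ℕ => ‖rightCoeff q b v w i * a ^ i‖ := by
  obtain ⟨C, hC, -, h2⟩ := exists_norm_qPoch_self_le hq
  obtain ⟨A, hA⟩ := (tendsto_qPoch hq (b * w)).norm.bddAbove_range
  obtain ⟨B, hB⟩ := (tendsto_ramanujanExp_mul_pow hq (b * v)).norm.bddAbove_range
  have hA' (n : ℕ) : ‖qPoch (b * w) q n‖ ≤ A := hA ⟨n, rfl⟩
  have hB' (n : ℕ) : ‖ramanujanExp q (b * v * q ^ n)‖ ≤ B := hB ⟨n, rfl⟩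
  have hA0 := (norm_nonneg _).trans (hA' 0)
  have hB0 := (norm_nonneg _).trans (hB' 0)
  refine Summable.of_nonneg_of_le (fun _ => norm_nonneg _) (fun n => ?_)
    ((summable_pow_sq_mul_pow (norm_nonneg q) hq ‖v * a‖).mul_left
      (‖1 / qPochInf (b * w) q‖ * (A * C * B)))
  rw [rightCoeff]
  calc _ = ‖1 / qPochInf (b * w) q‖ * (‖qPoch (b * w) q n‖ * ‖(qPoch q q n)⁻¹‖ *
        ‖ramanujanExp q (b * v * q ^ (2 * n))‖) * (‖q‖ ^ (n ^ 2) * ‖v * a‖ ^ n) := by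
        rw [← norm_pow, ← norm_pow, ← norm_mul, ← norm_mul, ← norm_mul, ← norm_mul, ← norm_mul]
        congr 1
        ring
    _ ≤ _ := by
        gcongr
        · exact hA' n
        · exact h2 n
        · exact hB' _

lemma summable_succ_mul_norm_ramanujanExp (hq : ‖q‖ < 1) (v : ℂ) {M : ℝ} (hM0 : 0 ≤ M) :
    Summable fun k : ℕ =>
      ((k : ℝ) + 1) * (‖q ^ (k ^ 2) * v ^ k / qPoch q q k‖ * M ^ k) := by
  refine Summable.of_nonneg_of_le (fun k => by positivity) (fun k => ?_)
    -- The weight k + 1 ≤ 2^k is absorbed by doubling the argument, R_q being entire.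
    (summable_norm_ramanujanExp hq (2 * M * v))
  have h2 : ((k : ℝ) + 1) ≤ 2 ^ k := by exact_mod_cast Nat.lt_two_pow_self
  calc _ ≤ 2 ^ k * (‖q ^ (k ^ 2) * v ^ k / qPoch q q k‖ * M ^ k) := by gcongr
    _ = _ := by
      simp only [norm_div, norm_mul, norm_pow, Complex.norm_real, Real.norm_eq_abs,
        abs_of_nonneg hM0, mul_pow, Complex.norm_ofNat]
      ring

lemma summable_succ_mul_norm_pow_div_qPoch (hq : ‖q‖ < 1) {w : ℂ} {M : ℝ} (hM0 : 0 ≤ M)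
    (hM : M * ‖w‖ < 1) :
    Summable fun m : ℕ => ((m : ℝ) + 1) * (‖w ^ m / qPoch q q m‖ * M ^ m) := by
  obtain ⟨D, hD, -, h2⟩ := exists_norm_qPoch_self_le hq
  have hr : ‖M * ‖w‖‖ < 1 := by rwa [Real.norm_of_nonneg (by positivity)]
  have s1 := summable_pow_mul_geometric_of_norm_lt_one 1 hr
  have s0 := summable_geometric_of_norm_lt_one hr
  refine Summable.of_nonneg_of_le (fun k => by positivity) (fun m => ?_)
    ((s1.add s0).mul_right D)
  rw [div_eq_mul_inv, norm_mul, norm_pow]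
  calc _ ≤ ((m : ℝ) + 1) * (‖w‖ ^ m * D * M ^ m) := by
        gcongr
        exact h2 m
    _ = _ := by ring

lemma norm_coeff_le (hq : ‖q‖ < 1) {a b : ℂ} {M C : ℝ} (ha : ‖a‖ ≤ M) (hb : ‖b‖ ≤ M)
    (hC : ∀ n j, ‖qBinom q n j‖ ≤ C) (x y z : ℂ) {n d : ℕ} (hd : d ≤ n) :
    ‖stieltjesWigert q n x y * z ^ n / qPoch q q n * (qBinom q n d * b ^ (n - d)) * a ^ d‖ ≤
      C * ∑ p ∈ Finset.HasAntidiagonal.antidiagonal n,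
        (‖q ^ (p.1 ^ 2) * (z * y) ^ p.1 / qPoch q q p.1‖ * M ^ p.1) *
          (‖(z * x) ^ p.2 / qPoch q q p.2‖ * M ^ p.2) := by
  have hM0 : 0 ≤ M := (norm_nonneg a).trans ha
  have hC0 : 0 ≤ C := (norm_nonneg _).trans (hC 0 0)
  rw [stieltjesWigert_mul_pow_div hq, norm_mul, norm_mul, norm_mul, norm_pow, norm_pow]
  calc _ ≤ (∑ p ∈ Finset.HasAntidiagonal.antidiagonal n,
          ‖q ^ (p.1 ^ 2) * (z * y) ^ p.1 / qPoch q q p.1‖ * ‖(z * x) ^ p.2 / qPoch q q p.2‖) *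
          (C * M ^ (n - d)) * M ^ d := by
        gcongr
        · refine (norm_sum_le _ _).trans (Finset.sum_le_sum fun p _ => ?_)
          rw [norm_mul]
        · exact hC _ _
    _ = C * ((∑ p ∈ Finset.HasAntidiagonal.antidiagonal n,
          ‖q ^ (p.1 ^ 2) * (z * y) ^ p.1 / qPoch q q p.1‖ * ‖(z * x) ^ p.2 / qPoch q q p.2‖) *
          M ^ n) := by
        rw [show M ^ n = M ^ (n - d) * M ^ d by rw [← pow_add, Nat.sub_add_cancel hd]]; ring
    _ = _ := by
        rw [Finset.sum_mul]
        congr 1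
        refine Finset.sum_congr rfl fun p hp => ?_
        have hn : p.1 + p.2 = n := by simpa using hp
        rw [← hn, pow_add]
        ring

/-- Row n has n + 1 possibly nonzero entries with a common bound, and n + 1 ≤ (k+1)(m+1) when k + m
= n; hence the weights in `hA` and `hB`. -/
lemma summable_prod_of_norm_le_sum_antidiagonal {F : ℕ × ℕ → ℂ} {A B : ℕ → ℝ} {C : ℝ}
    (hC : 0 ≤ C) (hA0 : ∀ k, 0 ≤ A k) (hB0 : ∀ k, 0 ≤ B k)
    (hA : Summable fun k : ℕ => ((k : ℝ) + 1) * A k)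
    (hB : Summable fun k : ℕ => ((k : ℝ) + 1) * B k)
    (hF : ∀ n d, d ≤ n →
      ‖F (n, d)‖ ≤ C * ∑ p ∈ Finset.HasAntidiagonal.antidiagonal n, A p.1 * B p.2)
    (hF0 : ∀ n d, n < d → F (n, d) = 0) : Summable F := by
  have hAB : Summable fun p : ℕ × ℕ => (((p.1 : ℝ) + 1) * A p.1) * (((p.2 : ℝ) + 1) * B p.2) :=
    hA.mul_of_nonneg hB (fun k => mul_nonneg (by positivity) (hA0 k))
      (fun k => mul_nonneg (by positivity) (hB0 k))
  have hAB' := summable_sum_mul_antidiagonal_of_summable_mul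
    (f := fun k : ℕ => ((k : ℝ) + 1) * A k) (g := fun k : ℕ => ((k : ℝ) + 1) * B k) hAB
  have hzero (n d : ℕ) (hd : d ∉ Finset.range (n + 1)) : ‖F (n, d)‖ = 0 := by
    rw [hF0 n d (by simpa using hd), norm_zero]
  refine Summable.of_norm ((summable_prod_of_nonneg fun _ => norm_nonneg _).mpr ⟨fun n => ?_, ?_⟩)
  · exact (hasSum_sum_of_ne_finset_zero (hzero n)).summable
  · refine Summable.of_nonneg_of_le (fun n => tsum_nonneg fun d => norm_nonneg _) (fun n => ?_)
      (hAB'.mul_left C)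
    rw [tsum_eq_sum (hzero n)]
    calc _ ≤ ∑ d ∈ Finset.range (n + 1), C * ∑ p ∈ Finset.HasAntidiagonal.antidiagonal n,
          A p.1 * B p.2 :=
          Finset.sum_le_sum fun d hd => hF n d (Nat.lt_succ_iff.mp (Finset.mem_range.mp hd))
      _ = C * ∑ p ∈ Finset.HasAntidiagonal.antidiagonal n, ((n : ℝ) + 1) * (A p.1 * B p.2) := by
          rw [Finset.sum_const, Finset.card_range, ← Finset.mul_sum, nsmul_eq_mul]
          push_cast
          ring
      _ ≤ _ := by
          refine mul_le_mul_of_nonneg_left (Finset.sum_le_sum fun p hp => ?_) hC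
          have hn : p.1 + p.2 = n := by simpa using hp
          have h1 : (n : ℝ) + 1 ≤ ((p.1 : ℝ) + 1) * ((p.2 : ℝ) + 1) := by
            rw [← hn]; push_cast
            nlinarith [mul_nonneg (p.1.cast_nonneg (α := ℝ)) (p.2.cast_nonneg (α := ℝ))]
          calc _ ≤ ((p.1 : ℝ) + 1) * ((p.2 : ℝ) + 1) * (A p.1 * B p.2) :=
                mul_le_mul_of_nonneg_right h1 (mul_nonneg (hA0 _) (hB0 _))
            _ = _ := by ring

lemma summable_coeff_prod (hq : ‖q‖ < 1) {a b x y z : ℂ} (ha : ‖a * (z * x)‖ < 1)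
    (hb : ‖b * (z * x)‖ < 1) :
    Summable fun p : ℕ × ℕ => stieltjesWigert q p.1 x y * z ^ p.1 / qPoch q q p.1 *
        (qBinom q p.1 p.2 * b ^ (p.1 - p.2)) * a ^ p.2 := by
  obtain ⟨M, hMa, hMb, hM⟩ : ∃ M : ℝ, ‖a‖ ≤ M ∧ ‖b‖ ≤ M ∧ M * ‖z * x‖ < 1 := by
    rw [norm_mul] at ha hb
    rcases le_total ‖a‖ ‖b‖ with h | h
    · exact ⟨_, h, le_rfl, hb⟩
    · exact ⟨_, le_rfl, h, ha⟩
  have hM0 : 0 ≤ M := (norm_nonneg a).trans hMa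
  obtain ⟨C, hC, hbin⟩ := exists_norm_qBinom_le hq
  exact summable_prod_of_norm_le_sum_antidiagonal hC.le
    (A := fun k => ‖q ^ (k ^ 2) * (z * y) ^ k / qPoch q q k‖ * M ^ k)
    (B := fun k => ‖(z * x) ^ k / qPoch q q k‖ * M ^ k)
    (fun k => mul_nonneg (norm_nonneg _) (pow_nonneg hM0 _))
    (fun k => mul_nonneg (norm_nonneg _) (pow_nonneg hM0 _))
    (summable_succ_mul_norm_ramanujanExp hq (z * y) hM0)
    (summable_succ_mul_norm_pow_div_qPoch hq hM0 hM)
    (fun n d hd => norm_coeff_le hq hMa hMb hbin x y z hd)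
    (fun n d hd => by
      rw [qBinom_of_lt q (by omega), zero_mul, mul_zero, zero_mul])

/-- The generating function, for complex `a`. -/
lemma hasSum_generatingFunction (hq : ‖q‖ < 1) {a b x y z : ℂ} (ha : ‖a * (z * x)‖ < 1)
    (hb : ‖b * (z * x)‖ < 1) :
    HasSum (fun n : ℕ => stieltjesWigert q n x y * rogersSzego q n a b * z ^ n / qPoch q q n)
      (1 / qPochInf (a * (z * x)) q * ∑' i : ℕ, rightCoeff q b (z * y) (z * x) i * a ^ i) := by
  have hs := (summable_coeff_prod (y := y) hq ha hb).hasSum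
  have hrow := hs.prod_fiberwise fun n => by
    refine hasSum_sum_of_ne_finset_zero (s := Finset.range (n + 1)) fun d hd => ?_
    rw [qBinom_of_lt q (by simpa using hd)]; simp
  have hcol := ((Equiv.prodComm ℕ ℕ).hasSum_iff.mpr hs).prod_fiberwise fun d =>
    (hasSum_coeff hq hb d).mul_right (a ^ d)
  have hE := hasSum_pow_div_qPoch hq ha
  have hR := (summable_norm_rightCoeff hq b (z * y) (z * x) a).of_norm.hasSum
  have hprod := hasSum_sum_antidiagonal (hasSum_mul_prod hR hE)
  -- Summing by columns d gives the Cauchy product of the `rightCoeff` series with Euler's series;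
  -- summing by rows n gives the original series.
  have hval := hcol.unique (hprod.congr_fun fun d => by
    rw [Finset.sum_mul]
    refine Finset.sum_congr rfl fun p hp => ?_
    rw [show d = p.1 + p.2 by simpa using Eq.symm (by simpa using hp), pow_add, mul_pow]
    ring)
  rw [mul_comm, ← hval]
  refine hrow.congr_fun fun n => ?_
  rw [rogersSzego_eq_sum, Finset.mul_sum, Finset.sum_mul, Finset.sum_div]
  refine Finset.sum_congr rfl fun d _ => ?_
  rw [smul_eq_mul]
  ring

open PowerSeries in
/-- The generating function, for an indeterminate `a`. -/
lemma hasSum_generatingFunction_X (hq : ‖q‖ < 1) {b x y z : ℂ} (hb : ‖b * (z * x)‖ < 1) :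
    HasSum (fun n : ℕ => (stieltjesWigert q n x y * z ^ n / qPoch q q n) •
        rogersSzego q n (PowerSeries.X : ℂ⟦X⟧) (PowerSeries.C b))
      ((qPochInf ((z * x) • (PowerSeries.X : ℂ⟦X⟧)) q)⁻¹ *
        PowerSeries.mk (rightCoeff q b (z * y) (z * x))) := by
  rw [inv_qPochInf_smul_X hq, mul_comm, WithPiTopology.hasSum_iff_hasSum_coeff]
  intro d
  simp only [coeff_mul, coeff_mk]
  refine (hasSum_coeff hq hb d).congr_fun fun n => ?_
  rw [coeff_smul, rogersSzego_eq_sum, map_sum, smul_eq_mul]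
  congr 1
  have (e : ℕ) : coeff d (qBinom q n e • ((X : ℂ⟦X⟧) ^ e * PowerSeries.C b ^ (n - e)))
      = if e = d then qBinom q n d * b ^ (n - d) else 0 := by
    rw [coeff_smul, ← map_pow, coeff_mul_C, coeff_X_pow]
    split_ifs <;> simp_all
  simp only [this, Finset.sum_ite_eq', Finset.mem_range]
  split_ifs with h
  · rfl
  · rw [qBinom_of_lt q (by omega)]; simp

end GeneratingFunction

/-! ### The Jacobi triple product, from the finite q-binomial theorem -/

section JacobiTripleProduct

/-- The coefficients `(-1)^j p^{j(j-1)/2}` of the theta series. -/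
noncomputable def thetaCoeff (p : ℂ) (j : ℤ) : ℂ := (-1) ^ j * p ^ (j * (j - 1) / 2)

variable {p : ℂ}

lemma thetaCoeff_add (hp0 : p ≠ 0) (n i : ℤ) :
    thetaCoeff p (n + i) = thetaCoeff p n * thetaCoeff p i * p ^ (n * i) := by
  obtain ⟨r, hr⟩ := Int.even_mul_pred_self n
  obtain ⟨s, hs⟩ := Int.even_mul_pred_self i
  have h : (n + i) * (n + i - 1) = (r + s + n * i) * 2 := by linear_combination hr + hs
  rw [thetaCoeff, thetaCoeff, thetaCoeff, h, hr, hs, ← mul_two, ← mul_two,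
    Int.mul_ediv_cancel _ two_ne_zero, Int.mul_ediv_cancel _ two_ne_zero,
    Int.mul_ediv_cancel _ two_ne_zero, zpow_add₀ (by simp), zpow_add₀ hp0, zpow_add₀ hp0]
  ring

lemma thetaCoeff_zero : thetaCoeff p 0 = 1 := by simp [thetaCoeff]

lemma thetaCoeff_one : thetaCoeff p 1 = -1 := by simp [thetaCoeff]

/-- The finite `q`-binomial theorem. -/
lemma hasSum_qBinom_thetaCoeff (hp : ‖p‖ < 1) (hp0 : p ≠ 0) {s : ℂ} (hs : s ≠ 0) (N : ℕ) :
    HasSum (fun j : ℤ => qBinom p N j * (thetaCoeff p j * s ^ j)) (qPoch s p N) := by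
  induction N with
  | zero =>
    have h := hasSum_single (f := fun j : ℤ => qBinom p 0 j * (thetaCoeff p j * s ^ j)) 0
      fun j hj => by
        rw [qBinom, if_neg (by omega), zero_mul]
    simpa [qBinom_zero_right hp, thetaCoeff_zero] using h
  | succ N ih =>
    -- The second Pascal term is the previous sum shifted by one and multiplied by -p^N s.
    have h := (Equiv.subRight (1 : ℤ)).hasSum_iff.mpr (ih.mul_left (-(p ^ N * s)))
    have h' := ih.add h
    rw [qPoch_succ, smul_eq_mul, mul_sub, mul_one, sub_eq_add_neg, ← mul_neg,
      mul_comm _ (-(p ^ N * s))]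
    refine h'.congr_fun fun j => ?_
    obtain ⟨i, rfl⟩ : ∃ i, j = i + 1 := ⟨j - 1, by ring⟩
    simp only [Function.comp, Equiv.subRight_apply, add_sub_cancel_right]
    rw [qBinom_succ' hp, thetaCoeff_add hp0, thetaCoeff_one, add_sub_cancel_right,
      show (N : ℤ) + 1 - (i + 1) = N - i by ring, zpow_sub₀ hp0, zpow_natCast, mul_one,
      zpow_add_one₀ hs]
    field_simp
    ring

/-- The factors are 1 - t p^{-k} for 1 ≤ k ≤ n; extracting -t p^{-k} from each leaves 1 - p^k/t. -/
lemma qPoch_mul_zpow_neg (hp0 : p ≠ 0) {t : ℂ} (ht : t ≠ 0) (n : ℕ) :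
    qPoch (t * p ^ (-n : ℤ)) p n
      = thetaCoeff p n * (t * p ^ (-n : ℤ)) ^ n * qPoch (p / t) p n := by
  induction n with
  | zero => simp [thetaCoeff_zero]
  | succ n ih =>
    have e : p ^ 1 • (t * p ^ (-(n + 1 : ℕ) : ℤ)) = t * p ^ (-n : ℤ) := by
      rw [smul_eq_mul, pow_one, mul_left_comm, ← zpow_one_add₀ hp0]
      congr 2
      push_cast
      ring
    rw [show qPoch (t * p ^ (-(n + 1 : ℕ) : ℤ)) p (n + 1)
      = qPoch (t * p ^ (-(n + 1 : ℕ) : ℤ)) p (1 + n) by rw [add_comm], qPoch_add, e, ih, qPoch_succ (p / t)]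
    rw [show qPoch (t * p ^ (-(n + 1 : ℕ) : ℤ)) p 1 = 1 - t * p ^ (-(n + 1 : ℕ) : ℤ) by
      simp [qPoch]]
    push_cast
    rw [thetaCoeff_add hp0, thetaCoeff_one, mul_one, smul_eq_mul, zpow_neg, zpow_neg, zpow_natCast,
      zpow_add_one₀ hp0, zpow_natCast, pow_succ (t * (p ^ n * p)⁻¹), mul_pow, mul_pow, inv_pow,
      inv_pow, mul_pow (p ^ n) p n]
    have hP : p ^ n ≠ 0 := pow_ne_zero n hp0
    generalize p ^ n = P at *
    field_simp
    ring

/-- The finite form of the Jacobi triple product identity. -/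
lemma hasSum_finite_jacobi (hp : ‖p‖ < 1) (hp0 : p ≠ 0) {t : ℂ} (ht : t ≠ 0) (n : ℕ) :
    HasSum (fun i : ℤ => qBinom p (2 * n) (n + i) * (thetaCoeff p i * t ^ i))
      (qPoch (p / t) p n * qPoch t p n) := by
  have hs : t * p ^ (-n : ℤ) ≠ 0 := mul_ne_zero ht (zpow_ne_zero _ hp0)
  have hk : thetaCoeff p n * (t * p ^ (-n : ℤ)) ^ n ≠ 0 := by
    refine mul_ne_zero ?_ (pow_ne_zero _ hs)
    exact mul_ne_zero (zpow_ne_zero _ (by simp)) (zpow_ne_zero _ hp0)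
  have e : p ^ n • (t * p ^ (-n : ℤ)) = t := by
    rw [smul_eq_mul, zpow_neg, zpow_natCast]
    field_simp
  -- The q-binomial theorem of order 2n at s = t p^{-n}, with the index recentred at j = n + i.
  have h := (Equiv.addLeft (n : ℤ)).hasSum_iff.mpr (hasSum_qBinom_thetaCoeff hp hp0 hs (2 * n))
  rw [two_mul, qPoch_add, e, qPoch_mul_zpow_neg hp0 ht, mul_assoc, ← two_mul] at h
  have h' := h.mul_left (thetaCoeff p n * (t * p ^ (-n : ℤ)) ^ n)⁻¹
  rw [inv_mul_cancel_left₀ hk] at h'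
  refine h'.congr_fun fun i => ?_
  simp only [Function.comp, Equiv.coe_addLeft]
  rw [eq_inv_mul_iff_mul_eq₀ hk, thetaCoeff_add hp0, zpow_add₀ hs, zpow_natCast, zpow_mul]
  have e' : (p ^ (n : ℤ)) ^ i * (t * p ^ (-n : ℤ)) ^ i = t ^ i := by
    rw [← mul_zpow, zpow_natCast]; exact congrArg (· ^ i) e
  rw [← e']
  ring

/-- The Jacobi triple product identity. -/
lemma tsum_thetaCoeff_mul_zpow (hp : ‖p‖ < 1) (hp0 : p ≠ 0) {t : ℂ} (ht : t ≠ 0)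
    (hs : Summable fun i : ℤ => ‖thetaCoeff p i * t ^ i‖) :
    ∑' i : ℤ, thetaCoeff p i * t ^ i
      = qPochInf (p / t) p * qPochInf t p * qPochInf p p := by
  obtain ⟨C, hC, hbin⟩ := exists_norm_qBinom_le hp
  have h1 : Tendsto (fun n : ℕ => ∑' i : ℤ, qBinom p (2 * n) (n + i) * (thetaCoeff p i * t ^ i))
      atTop (𝓝 (∑' i : ℤ, 1 / qPochInf p p * (thetaCoeff p i * t ^ i))) := by
    refine tendsto_tsum_of_dominated_convergence (hs.mul_left C) (fun i => ?_)
      (Eventually.of_forall fun n i => ?_)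
    · refine (tendsto_qBinom hp ?_ ?_).mul_const _
      · exact tendsto_atTop.mpr fun b =>
          (eventually_ge_atTop (b - i).toNat).mono fun n hn => by omega
      · exact tendsto_atTop.mpr fun b =>
          (eventually_ge_atTop (b + i).toNat).mono fun n hn => by push_cast; omega
    · rw [norm_mul]
      exact mul_le_mul_of_nonneg_right (hbin _ _) (norm_nonneg _)
  have h2 := (tendsto_qPoch hp (p / t)).mul (tendsto_qPoch hp t)
  have h3 := tendsto_nhds_unique h1
    (h2.congr fun n => (hasSum_finite_jacobi hp hp0 ht n).tsum_eq.symm)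
  have hE := qPochInf_ne_zero hp hp
  rw [tsum_mul_left] at h3
  rw [← h3]
  field_simp

end JacobiTripleProduct

/-! ### Garrett's polynomials and the Rogers–Ramanujan identities -/

section Garrett

variable {q : ℂ}

/-- The exponents in Garrett's polynomials: `σ = 1` for `a`, `σ = 0` for `b`. -/
def garrettExp (σ i : ℤ) : ℤ := i * (5 * i + 1 - 4 * σ) / 2

lemma garrettExp_succ (σ i : ℤ) : garrettExp σ (i + 1) = garrettExp σ i + (5 * i + 3 - 2 * σ) := by
  rw [garrettExp, garrettExp, show (i + 1) * (5 * (i + 1) + 1 - 4 * σ)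
    = i * (5 * i + 1 - 4 * σ) + (5 * i + 3 - 2 * σ) * 2 by ring,
    Int.add_mul_ediv_right _ _ two_ne_zero]

lemma natAbs_le_garrettExp {σ : ℤ} (h0 : 0 ≤ σ) (h1 : σ ≤ 1) (i : ℤ) :
    (i.natAbs : ℤ) ≤ garrettExp σ i := by
  rw [garrettExp, Int.le_ediv_iff_mul_le two_pos]
  rcases lt_trichotomy i 0 with h | h | h
  · rw [Int.ofNat_natAbs_of_nonpos h.le]; nlinarith
  · simp [h]
  · rw [Int.natAbs_of_nonneg h.le]; nlinarith

/-- Both families of Garrett's polynomials (`σ = 1` and `σ = 0`) at index `n + 1`. -/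
noncomputable def garrettSum (q : ℂ) (σ : ℤ) (n : ℕ) : ℂ :=
  ∑' i : ℤ, (-1) ^ i * q ^ garrettExp σ i * qBinom q n ((n - 5 * i) / 2 + σ)

lemma finite_support_mul_qBinom (n N : ℕ) (τ : ℤ) (c : ℤ → ℂ) :
    (Function.support fun i : ℤ => c i * qBinom q n ((N - 5 * i) / 2 + τ)).Finite := by
  refine (Set.finite_Icc (-(n : ℤ) - N - 1 - 2 * τ.natAbs)
    (n + N + 1 + 2 * τ.natAbs)).subset fun i hi => ?_
  by_contra h
  rw [Set.mem_Icc] at h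
  refine hi ?_
  simp only []
  rw [qBinom, if_neg (by omega), mul_zero]

lemma summable_mul_qBinom (n N : ℕ) (τ : ℤ) (c : ℤ → ℂ) :
    Summable fun i : ℤ => c i * qBinom q n ((N - 5 * i) / 2 + τ) :=
  summable_of_hasFiniteSupport (finite_support_mul_qBinom n N τ c)

lemma garrettA_succ (n : ℕ) : garrettA q (n + 1) = garrettSum q 1 n := by
  rw [garrettA, if_neg (by omega), garrettSum,
    tsum_eq_finsum (finite_support_mul_qBinom n n 1 _)]
  refine finsum_congr fun i => ?_
  rw [garrettExp, show (((n + 1 : ℕ) : ℤ) + 1 - 5 * i) / 2 = (n - 5 * i) / 2 + 1 by omega,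
    show 5 * i + 1 - 4 * 1 = 5 * i - 3 by ring, Nat.add_sub_cancel]

lemma garrettB_succ (n : ℕ) : garrettB q (n + 1) = garrettSum q 0 n := by
  rw [garrettB, if_neg (by omega), garrettSum,
    tsum_eq_finsum (finite_support_mul_qBinom n n 0 _)]
  refine finsum_congr fun i => ?_
  rw [garrettExp, show (((n + 1 : ℕ) : ℤ) - 1 - 5 * i) / 2 = (n - 5 * i) / 2 + 0 by omega,
    show 5 * i + 1 - 4 * 0 = 5 * i + 1 by ring, Nat.add_sub_cancel]

lemma qBinom_add_two (hq : ‖q‖ < 1) (hq0 : q ≠ 0) (n : ℕ) (h : ℤ) :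
    qBinom q (n + 2) (h + 1) = qBinom q (n + 1) h + q ^ (n + 1) * qBinom q n h
      + q ^ (h + 1) * qBinom q n (h + 1) := by
  rw [qBinom_succ hq (n + 1), qBinom_succ' hq n (h + 1), add_sub_cancel_right, mul_add,
    ← mul_assoc, ← zpow_add₀ hq0, show h + 1 + ((n : ℤ) + 1 - (h + 1)) = (n + 1 : ℕ) by
      push_cast; ring, zpow_natCast]
  ring

/-- Companion of `qBinom_add_two` with the two Pascal rules in the opposite order; the parity of n -
i decides which one fits the floor in Garrett's sums. -/
lemma qBinom_add_two' (hq : ‖q‖ < 1) (hq0 : q ≠ 0) (n : ℕ) (h : ℤ) :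
    qBinom q (n + 2) (h + 1) = qBinom q (n + 1) (h + 1) + q ^ (n + 1) * qBinom q n h
      + q ^ ((n : ℤ) + 1 - h) * qBinom q n (h - 1) := by
  rw [qBinom_succ' hq (n + 1), add_sub_cancel_right, qBinom_succ hq n h, mul_add, ← mul_assoc,
    ← zpow_add₀ hq0, show ((n + 1 : ℕ) : ℤ) + 1 - (h + 1) + h = (n + 1 : ℕ) by ring,
    zpow_natCast, show ((n + 1 : ℕ) : ℤ) + 1 - (h + 1) = n + 1 - h by push_cast; ring]
  ring

/-- The telescoping terms in the recurrence for Garrett's polynomials. -/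
noncomputable def garrettDiff (q : ℂ) (σ : ℤ) (n : ℕ) (i : ℤ) : ℂ :=
  (if Even ((n : ℤ) - i) then
    (-1) ^ i * q ^ garrettExp σ i * q ^ (((n : ℤ) - 5 * i) / 2 + (σ + 1)) else 0) *
      qBinom q n ((n - 5 * i) / 2 + (σ + 1))

lemma summable_garrettDiff (σ : ℤ) (n : ℕ) : Summable (garrettDiff q σ n) :=
  summable_mul_qBinom n n (σ + 1) _

lemma summable_garrettSum (σ : ℤ) (n : ℕ) : Summable fun i : ℤ =>
    (-1) ^ i * q ^ garrettExp σ i * qBinom q n ((n - 5 * i) / 2 + σ) :=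
  summable_mul_qBinom n n σ _

/-- From n to n + 1 the floor of (n - 5i)/2 is unchanged if n - i is even and grows by 1 if it is
odd. In the even case the surplus Pascal term is `garrettDiff` at i, in the odd case minus
`garrettDiff` at i + 1. As `garrettDiff` vanishes at the other parity, one telescoping difference
covers both. -/
lemma garrettSum_term_add_two (hq : ‖q‖ < 1) (hq0 : q ≠ 0) (σ : ℤ) (n : ℕ) (i : ℤ) :
    (-1) ^ i * q ^ garrettExp σ i * qBinom q (n + 2) (((n + 2 : ℕ) - 5 * i) / 2 + σ)
      = (-1) ^ i * q ^ garrettExp σ i * qBinom q (n + 1) (((n + 1 : ℕ) - 5 * i) / 2 + σ)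
        + q ^ (n + 1) * ((-1) ^ i * q ^ garrettExp σ i * qBinom q n ((n - 5 * i) / 2 + σ))
        + (garrettDiff q σ n i - garrettDiff q σ n (i + 1)) := by
  have hsign : (-1 : ℂ) ^ (i + 1) = -(-1) ^ i := by rw [zpow_add_one₀ (by simp)]; ring
  obtain ⟨h, hh⟩ : ∃ h, h = ((n : ℤ) - 5 * i) / 2 + σ := ⟨_, rfl⟩
  rcases Int.even_or_odd ((n : ℤ) - i) with he | ho
  · have ho : ¬ Even ((n : ℤ) - (i + 1)) := by
      rw [Int.even_iff] at he ⊢; omega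
    rw [garrettDiff, garrettDiff, if_neg ho, if_pos he]
    rw [Int.even_iff] at he
    rw [show (((n + 2 : ℕ) : ℤ) - 5 * i) / 2 + σ = h + 1 by omega,
      show (((n + 1 : ℕ) : ℤ) - 5 * i) / 2 + σ = h by omega,
      show ((n : ℤ) - 5 * i) / 2 + (σ + 1) = h + 1 by omega, ← hh, qBinom_add_two hq hq0]
    ring
  · have he : Even ((n : ℤ) - (i + 1)) := by
      rw [Int.odd_iff] at ho; rw [Int.even_iff]; omega
    rw [garrettDiff, garrettDiff, if_pos he, if_neg (Int.not_even_iff_odd.mpr ho)]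
    rw [Int.odd_iff] at ho
    rw [show (((n + 2 : ℕ) : ℤ) - 5 * i) / 2 + σ = h + 1 by omega,
      show (((n + 1 : ℕ) : ℤ) - 5 * i) / 2 + σ = h + 1 by omega,
      show ((n : ℤ) - 5 * (i + 1)) / 2 + (σ + 1) = h - 1 by omega, ← hh, qBinom_add_two' hq hq0,
      hsign, garrettExp_succ, zpow_add₀ hq0,
      show (n : ℤ) + 1 - h = (5 * i + 3 - 2 * σ) + (h - 1) by omega,
      zpow_add₀ hq0 (5 * i + 3 - 2 * σ)]
    ring

lemma garrettSum_add_two (hq : ‖q‖ < 1) (hq0 : q ≠ 0) (σ : ℤ) (n : ℕ) :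
    garrettSum q σ (n + 2) = garrettSum q σ (n + 1) + q ^ (n + 1) * garrettSum q σ n := by
  have key := garrettSum_term_add_two hq hq0 σ n
  have hV := summable_garrettDiff (q := q) σ n
  have hV' := (Equiv.addRight (1 : ℤ)).hasSum_iff.mpr hV.hasSum
  have h := ((summable_garrettSum (q := q) σ (n + 1)).hasSum.add
    ((summable_garrettSum (q := q) σ n).hasSum.mul_left (q ^ (n + 1)))).add (hV.hasSum.sub hV')
  rw [sub_self, add_zero] at h
  exact (h.congr_fun key).tsum_eq

lemma garrettSum_one_zero : garrettSum q 1 0 = 0 :=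
  (tsum_congr fun i => by rw [qBinom, if_neg (by omega), mul_zero]).trans tsum_zero

lemma garrettSum_one_one (hq : ‖q‖ < 1) : garrettSum q 1 1 = 1 := by
  rw [garrettSum, tsum_eq_single 0 fun i hi => by rw [qBinom, if_neg (by omega), mul_zero]]
  simpa [garrettExp] using qBinom_self hq 1

lemma garrettSum_zero_zero (hq : ‖q‖ < 1) : garrettSum q 0 0 = 1 := by
  rw [garrettSum, tsum_eq_single 0 fun i hi => by rw [qBinom, if_neg (by omega), mul_zero]]
  simpa [garrettExp] using qBinom_self hq 0

lemma garrettSum_zero_one (hq : ‖q‖ < 1) : garrettSum q 0 1 = 1 := by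
  rw [garrettSum, tsum_eq_single 0 fun i hi => by rw [qBinom, if_neg (by omega), mul_zero]]
  simpa [garrettExp] using qBinom_zero_right hq 1

lemma garrettA_zero : garrettA q 0 = 1 := if_pos rfl

lemma garrettB_zero : garrettB q 0 = 0 := if_pos rfl

lemma garrettA_add_two (hq : ‖q‖ < 1) (hq0 : q ≠ 0) (k : ℕ) :
    garrettA q (k + 2) = garrettA q (k + 1) + q ^ k * garrettA q k := by
  -- The separately defined value at index 0 is the one that extends the recurrence down to k = 0.
  rcases k with _ | k
  · rw [garrettA_succ, garrettA_succ, garrettA_zero, garrettSum_one_one hq, garrettSum_one_zero]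
    simp
  · simp only [garrettA_succ, garrettSum_add_two hq hq0]

lemma garrettB_add_two (hq : ‖q‖ < 1) (hq0 : q ≠ 0) (k : ℕ) :
    garrettB q (k + 2) = garrettB q (k + 1) + q ^ k * garrettB q k := by
  rcases k with _ | k
  · rw [garrettB_succ, garrettB_succ, garrettB_zero, garrettSum_zero_one hq,
      garrettSum_zero_zero hq]
    simp
  · simp only [garrettB_succ, garrettSum_add_two hq hq0]

lemma summable_norm_garrettExp (hq : ‖q‖ < 1) (hq0 : q ≠ 0) {σ : ℤ} (h0 : 0 ≤ σ) (h1 : σ ≤ 1) :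
    Summable fun i : ℤ => ‖(-1) ^ i * q ^ garrettExp σ i‖ := by
  have hs := summable_geometric_of_lt_one (norm_nonneg q) hq
  have hs' : Summable fun i : ℤ => ‖q‖ ^ i.natAbs :=
    Summable.of_nat_of_neg (by simpa using hs) (by simpa using hs)
  refine Summable.of_nonneg_of_le (fun _ => norm_nonneg _) (fun i => ?_) hs'
  rw [norm_mul, norm_zpow, norm_zpow, norm_neg, norm_one, one_zpow, one_mul, ← zpow_natCast]
  exact zpow_le_zpow_right_of_le_one₀ (norm_pos_iff.mpr hq0) hq.le (natAbs_le_garrettExp h0 h1 i)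

lemma tendsto_garrettSum (hq : ‖q‖ < 1) (hq0 : q ≠ 0) {σ : ℤ} (h0 : 0 ≤ σ) (h1 : σ ≤ 1) :
    Tendsto (garrettSum q σ) atTop
      (𝓝 ((∑' i : ℤ, (-1) ^ i * q ^ garrettExp σ i) / qPochInf q q)) := by
  obtain ⟨C, hC, hbin⟩ := exists_norm_qBinom_le hq
  rw [div_eq_mul_one_div, ← tsum_mul_right]
  refine tendsto_tsum_of_dominated_convergence
    ((summable_norm_garrettExp hq hq0 h0 h1).mul_right C) (fun i => ?_)
    (Eventually.of_forall fun n i => ?_)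
  · refine (tendsto_qBinom hq ?_ ?_).const_mul _
    · exact tendsto_atTop.mpr fun b =>
        (eventually_ge_atTop (2 * b + 5 * i + 10).toNat).mono fun n hn => by omega
    · exact tendsto_atTop.mpr fun b =>
        (eventually_ge_atTop (2 * b - 5 * i + 10).toNat).mono fun n hn => by omega
  · rw [norm_mul]
    exact mul_le_mul_of_nonneg_left (hbin _ _) (norm_nonneg _)

/-- Garrett's exponent equals 5 i(i-1)/2 + (3 - 2σ) i, so the limiting series is a theta series with
p = q^5, t = q^{3-2σ}. -/
lemma thetaCoeff_pow_five (q : ℂ) (hq0 : q ≠ 0) {σ : ℤ} (i : ℤ) :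
    thetaCoeff (q ^ 5) i * (q ^ (3 - 2 * σ)) ^ i = (-1) ^ i * q ^ garrettExp σ i := by
  obtain ⟨r, hr⟩ := Int.even_mul_pred_self i
  have h : i * (5 * i + 1 - 4 * σ) = (5 * r + (3 - 2 * σ) * i) * 2 := by linear_combination 5 * hr
  rw [thetaCoeff, garrettExp, hr, h, ← mul_two, Int.mul_ediv_cancel _ two_ne_zero,
    Int.mul_ediv_cancel _ two_ne_zero, zpow_add₀ hq0, zpow_mul, zpow_mul, mul_assoc]
  norm_cast

lemma norm_pow_lt_one (hq : ‖q‖ < 1) {n : ℕ} (hn : n ≠ 0) : ‖q ^ n‖ < 1 := by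
  rw [norm_pow]; exact pow_lt_one₀ (norm_nonneg _) hq hn

lemma tsum_garrettExp (hq : ‖q‖ < 1) (hq0 : q ≠ 0) {σ : ℤ} (h0 : 0 ≤ σ) (h1 : σ ≤ 1) :
    ∑' i : ℤ, (-1) ^ i * q ^ garrettExp σ i
      = qPochInf (q ^ 5 / q ^ (3 - 2 * σ)) (q ^ 5) * qPochInf (q ^ (3 - 2 * σ)) (q ^ 5) *
        qPochInf (q ^ 5) (q ^ 5) := by
  rw [← tsum_thetaCoeff_mul_zpow (norm_pow_lt_one hq (by norm_num)) (pow_ne_zero 5 hq0)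
    (zpow_ne_zero _ hq0)]
  · exact tsum_congr fun i => (thetaCoeff_pow_five q hq0 i).symm
  · simp only [thetaCoeff_pow_five q hq0]
    exact summable_norm_garrettExp hq hq0 h0 h1

/-- Splitting `(q;q)_∞` according to residues modulo `5`. -/
lemma qPochInf_self_eq_prod (hq : ‖q‖ < 1) :
    qPochInf q q = qPochInf q (q ^ 5) * qPochInf (q ^ 2) (q ^ 5) * qPochInf (q ^ 3) (q ^ 5) *
      qPochInf (q ^ 4) (q ^ 5) * qPochInf (q ^ 5) (q ^ 5) := by
  have h5 := norm_pow_lt_one hq (n := 5) (by norm_num)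
  have key (n : ℕ) : qPoch q q (5 * n) = qPoch q (q ^ 5) n * qPoch (q ^ 2) (q ^ 5) n *
      qPoch (q ^ 3) (q ^ 5) n * qPoch (q ^ 4) (q ^ 5) n * qPoch (q ^ 5) (q ^ 5) n := by
    induction n with
    | zero => simp
    | succ n ih =>
      rw [show 5 * (n + 1) = 5 * n + 1 + 1 + 1 + 1 + 1 by ring]
      simp only [qPoch_succ, ih, smul_eq_mul]
      ring
  have h1 := (tendsto_qPoch hq q).comp (tendsto_id.const_mul_atTop' (by norm_num : 0 < 5))
  have h2 := ((((tendsto_qPoch h5 q).mul (tendsto_qPoch h5 (q ^ 2))).mul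
    (tendsto_qPoch h5 (q ^ 3))).mul (tendsto_qPoch h5 (q ^ 4))).mul (tendsto_qPoch h5 (q ^ 5))
  exact tendsto_nhds_unique h1 (h2.congr fun n => (key n).symm)

lemma tendsto_garrettA (hq : ‖q‖ < 1) (hq0 : q ≠ 0) :
    Tendsto (garrettA q) atTop
      (𝓝 (1 / (qPochInf (q ^ 2) (q ^ 5) * qPochInf (q ^ 3) (q ^ 5)))) := by
  rw [← tendsto_add_atTop_iff_nat 1]
  have h5 := norm_pow_lt_one hq (n := 5) (by norm_num)
  have e1 := qPochInf_ne_zero h5 hq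
  have e4 := qPochInf_ne_zero h5 (norm_pow_lt_one hq (n := 4) (by norm_num))
  have e5 := qPochInf_ne_zero h5 h5
  have h := tendsto_garrettSum hq hq0 zero_le_one le_rfl
  rw [tsum_garrettExp hq hq0 zero_le_one le_rfl, qPochInf_self_eq_prod hq,
    show q ^ (3 - 2 * 1 : ℤ) = q by norm_num,
    show q ^ 5 / q = q ^ 4 by field_simp] at h
  refine Tendsto.congr (fun n => (garrettA_succ n).symm) (h.trans_eq ?_)
  congr 1
  field_simp

lemma tendsto_garrettB (hq : ‖q‖ < 1) (hq0 : q ≠ 0) :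
    Tendsto (garrettB q) atTop
      (𝓝 (1 / (qPochInf q (q ^ 5) * qPochInf (q ^ 4) (q ^ 5)))) := by
  rw [← tendsto_add_atTop_iff_nat 1]
  have h5 := norm_pow_lt_one hq (n := 5) (by norm_num)
  have e2 := qPochInf_ne_zero h5 (norm_pow_lt_one hq (n := 2) (by norm_num))
  have e3 := qPochInf_ne_zero h5 (norm_pow_lt_one hq (n := 3) (by norm_num))
  have e5 := qPochInf_ne_zero h5 h5
  have h := tendsto_garrettSum hq hq0 le_rfl zero_le_one
  rw [tsum_garrettExp hq hq0 le_rfl zero_le_one, qPochInf_self_eq_prod hq,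
    show q ^ (3 - 2 * 0 : ℤ) = q ^ 3 by norm_cast,
    show q ^ 5 / q ^ 3 = q ^ 2 by field_simp] at h
  refine Tendsto.congr (fun n => (garrettB_succ n).symm) (h.trans_eq ?_)
  congr 1
  field_simp

lemma ramanujanExp_eq_add (hq : ‖q‖ < 1) (u : ℂ) :
    ramanujanExp q u = ramanujanExp q (q * u) + q * u * ramanujanExp q (q ^ 2 * u) := by
  have s0 := (hasSum_ramanujanExp hq u).summable
  have s1 := (hasSum_ramanujanExp hq (q * u)).summable
  rw [← sub_eq_iff_eq_add', ramanujanExp, ramanujanExp, ramanujanExp, ← s0.tsum_sub s1,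
    (s0.sub s1).tsum_eq_zero_add, ← tsum_mul_left]
  simp only [pow_zero, sub_self, zero_add]
  refine tsum_congr fun n => ?_
  have := one_sub_pow_ne_zero hq n
  have := qPoch_self_ne_zero hq n
  rw [qPoch_self_succ]
  field_simp
  ring

lemma ramanujanExp_pow_eq_add (hq : ‖q‖ < 1) (m : ℕ) :
    ramanujanExp q (q ^ m)
      = ramanujanExp q (q ^ (m + 1)) + q ^ (m + 1) * ramanujanExp q (q ^ (m + 2)) := by
  have := ramanujanExp_eq_add hq (q ^ m)
  rwa [← pow_succ', ← pow_add, add_comm 2 m] at this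

/-- The two recurrences are adjoint: c_{m+1} R_q(q^m) + q^m c_m R_q(q^{m+1}) does not depend on m.
Its value at m = 0 is the left side, its limit is L. -/
lemma ramanujanExp_eq_of_tendsto (hq : ‖q‖ < 1) {c : ℕ → ℂ} {L : ℂ}
    (hc : ∀ k, c (k + 2) = c (k + 1) + q ^ k * c k) (hL : Tendsto c atTop (𝓝 L)) :
    c 1 * ramanujanExp q 1 + c 0 * ramanujanExp q q = L := by
  have hR : Tendsto (fun m : ℕ => ramanujanExp q (q ^ m)) atTop (𝓝 1) := by
    simpa using tendsto_ramanujanExp_mul_pow hq 1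
  have key (m : ℕ) : c (m + 1) * ramanujanExp q (q ^ m)
      + q ^ m * c m * ramanujanExp q (q ^ (m + 1))
      = c 1 * ramanujanExp q 1 + c 0 * ramanujanExp q q := by
    induction m with
    | zero => simp
    | succ m ih =>
      rw [← ih, hc, ramanujanExp_pow_eq_add hq m]
      ring
  have h := ((hL.comp (tendsto_add_atTop_nat 1)).mul hR).add
    (((tendsto_pow_atTop_nhds_zero_of_norm_lt_one hq).mul hL).mul
      (hR.comp (tendsto_add_atTop_nat 1)))
  have h' := tendsto_nhds_unique (tendsto_const_nhds.congr fun m => (key m).symm) h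
  simpa using h'

/-- The first Rogers–Ramanujan identity. -/
lemma ramanujanExp_one (hq : ‖q‖ < 1) (hq0 : q ≠ 0) :
    ramanujanExp q 1 = 1 / (qPochInf q (q ^ 5) * qPochInf (q ^ 4) (q ^ 5)) := by
  have h := ramanujanExp_eq_of_tendsto hq (garrettB_add_two hq hq0) (tendsto_garrettB hq hq0)
  rwa [garrettB_succ, garrettSum_zero_zero hq, garrettB_zero, one_mul, zero_mul, add_zero] at h

/-- The second Rogers–Ramanujan identity. -/
lemma ramanujanExp_self (hq : ‖q‖ < 1) (hq0 : q ≠ 0) :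
    ramanujanExp q q = 1 / (qPochInf (q ^ 2) (q ^ 5) * qPochInf (q ^ 3) (q ^ 5)) := by
  have h := ramanujanExp_eq_of_tendsto hq (garrettA_add_two hq hq0) (tendsto_garrettA hq hq0)
  rwa [garrettA_succ, garrettSum_one_zero, garrettA_zero, one_mul, zero_mul, zero_add] at h

/-- The `m`-version of the Rogers–Ramanujan identities. -/
lemma pow_choose_mul_ramanujanExp (hq : ‖q‖ < 1) (hq0 : q ≠ 0) (m : ℕ) :
    q ^ (m.choose 2) * ramanujanExp q (q ^ m) = (-1) ^ m *
      (garrettA q m * ramanujanExp q 1 - garrettB q m * ramanujanExp q q) := by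
  induction m using Nat.twoStepInduction with
  | zero => simp [garrettA_zero, garrettB_zero]
  | one => simp [garrettA_succ, garrettB_succ, garrettSum_one_zero, garrettSum_zero_zero hq]
  | more m h0 h1 =>
    have e0 : (m + 1).choose 2 = m + m.choose 2 := by
      rw [Nat.choose_succ_succ' m 1, Nat.choose_one_right]
    have e1 : (m + 2).choose 2 = m + 1 + (m + 1).choose 2 := by
      rw [Nat.choose_succ_succ' (m + 1) 1, Nat.choose_one_right]
    have hr := ramanujanExp_pow_eq_add hq m
    rw [garrettA_add_two hq hq0, garrettB_add_two hq hq0, e1]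
    rw [e0] at h1 ⊢
    rw [pow_add] at h1
    rw [pow_add, pow_add q m]
    linear_combination q ^ m * h0 - h1 - q ^ m * q ^ m.choose 2 * hr

/-- The case m = 2i, where the sign disappears and i² = C(2i, 2) - i(i-1). -/
lemma pow_sq_mul_ramanujanExp (hq : ‖q‖ < 1) (hq0 : q ≠ 0) (i : ℕ) :
    q ^ (i ^ 2) * ramanujanExp q (q ^ (2 * i)) = q ^ (-((i : ℤ) * ((i : ℤ) - 1))) *
      (garrettA q (2 * i) / (qPochInf q (q ^ 5) * qPochInf (q ^ 4) (q ^ 5)) -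
        garrettB q (2 * i) / (qPochInf (q ^ 2) (q ^ 5) * qPochInf (q ^ 3) (q ^ 5))) := by
  have h := pow_choose_mul_ramanujanExp hq hq0 (2 * i)
  rw [ramanujanExp_one hq hq0, ramanujanExp_self hq hq0, mul_one_div, mul_one_div,
    (even_two_mul i).neg_one_pow, one_mul] at h
  have e : ((2 * i).choose 2 : ℤ) = i * (2 * i - 1) := by
    rw [Nat.choose_two_right, mul_assoc, Nat.mul_div_cancel_left _ two_pos]
    rcases i with _ | i
    · simp
    · push_cast [show 2 * (i + 1) - 1 = 2 * i + 1 by omega]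
      ring
  rw [← h, ← mul_assoc, ← zpow_natCast q ((2 * i).choose 2), ← zpow_add₀ hq0, e,
    show -((i : ℤ) * (i - 1)) + i * (2 * i - 1) = (i ^ 2 : ℕ) by push_cast; ring, zpow_natCast]

end Garrett

/-! ### Specialisation to bzy = 1 and the main theorem -/

lemma rightCoeff_of_mul_eq_one {q : ℂ} (hq : ‖q‖ < 1) (hq0 : q ≠ 0) {b v : ℂ} (h : b * v = 1)
    (w : ℂ) (i : ℕ) :
    rightCoeff q b v w i = 1 / qPochInf (b * w) q *
      (q ^ (-((i : ℤ) * ((i : ℤ) - 1))) * (qPoch (b * w) q i / qPoch q q i) *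
        (garrettA q (2 * i) / (qPochInf q (q ^ 5) * qPochInf (q ^ 4) (q ^ 5)) -
          garrettB q (2 * i) / (qPochInf (q ^ 2) (q ^ 5) * qPochInf (q ^ 3) (q ^ 5))) * v ^ i) := by
  have e := pow_sq_mul_ramanujanExp hq hq0 i
  rw [rightCoeff, h, one_mul]
  linear_combination 1 / qPochInf (b * w) q * (qPoch (b * w) q i / qPoch q q i) * v ^ i * e

theorem mainTheorem4 (q : ℂ) (hq : ‖q‖ < 1) (b x y z : ℂ) (hb : ‖b * z * x‖ < 1) :
    -- the generating function
    (∀ a : ℂ, ‖a * z * x‖ < 1 →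
      Summable (fun i : ℕ => q ^ (i ^ 2) * qPoch (b * z * x) q i / qPoch q q i *
          (a * z * y) ^ i * ramanujanExp q (b * z * q ^ (2 * i) * y)) ∧
      HasSum (fun n : ℕ => stieltjesWigert q n x y * rogersSzego q n a b * z ^ n / qPoch q q n)
        (1 / (qPochInf (a * z * x) q * qPochInf (b * z * x) q) *
          ∑' i : ℕ, q ^ (i ^ 2) * qPoch (b * z * x) q i / qPoch q q i *
            (a * z * y) ^ i * ramanujanExp q (b * z * q ^ (2 * i) * y))) ∧
    -- the case `b z y = 1`
    (q ≠ 0 → b * z * y = 1 →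
      -- for complex `a`, the two series being added term by term
      (∀ a : ℂ, ‖a * z * x‖ < 1 →
        Summable (fun i : ℕ => q ^ (-((i : ℤ) * ((i : ℤ) - 1))) *
          (qPoch (b * z * x) q i / qPoch q q i) *
          (garrettA q (2 * i) / (qPochInf q (q ^ 5) * qPochInf (q ^ 4) (q ^ 5)) -
            garrettB q (2 * i) / (qPochInf (q ^ 2) (q ^ 5) * qPochInf (q ^ 3) (q ^ 5))) *
          (a * z * y) ^ i) ∧
        HasSum (fun n : ℕ => stieltjesWigert q n x y * rogersSzego q n a b * z ^ n / qPoch q q n)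
          (1 / (qPochInf (a * z * x) q * qPochInf (b * z * x) q) *
            ∑' i : ℕ, q ^ (-((i : ℤ) * ((i : ℤ) - 1))) *
              (qPoch (b * z * x) q i / qPoch q q i) *
              (garrettA q (2 * i) / (qPochInf q (q ^ 5) * qPochInf (q ^ 4) (q ^ 5)) -
                garrettB q (2 * i) / (qPochInf (q ^ 2) (q ^ 5) * qPochInf (q ^ 3) (q ^ 5))) *
              (a * z * y) ^ i)) ∧
      -- for `a = X` an indeterminate, with two separate series, in `ℂ⟦X⟧`
      HasSum (fun n : ℕ => (stieltjesWigert q n x y * z ^ n / qPoch q q n) •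
          rogersSzego q n (PowerSeries.X : ℂ⟦X⟧) (PowerSeries.C b))
        ((1 / (qPochInf (b * z * x) q * (qPochInf q (q ^ 5) * qPochInf (q ^ 4) (q ^ 5)))) •
            ((qPochInf ((z * x) • (PowerSeries.X : ℂ⟦X⟧)) q)⁻¹ *
              PowerSeries.mk (fun i : ℕ => q ^ (-((i : ℤ) * ((i : ℤ) - 1))) *
                (qPoch (b * z * x) q i / qPoch q q i) * garrettA q (2 * i) * (z * y) ^ i)) -
          (1 / (qPochInf (b * z * x) q * (qPochInf (q ^ 2) (q ^ 5) * qPochInf (q ^ 3) (q ^ 5)))) •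
            ((qPochInf ((z * x) • (PowerSeries.X : ℂ⟦X⟧)) q)⁻¹ *
              PowerSeries.mk (fun i : ℕ => q ^ (-((i : ℤ) * ((i : ℤ) - 1))) *
                (qPoch (b * z * x) q i / qPoch q q i) * garrettB q (2 * i) * (z * y) ^ i)))) := by
  have hb' : ‖b * (z * x)‖ < 1 := by rwa [← mul_assoc]
  have hE := qPochInf_ne_zero hq hb
  -- Both complex identities have this shape, with f the summand once the nonzero constant
  -- 1/(bzx;q)_∞ is removed from `rightCoeff`.
  have main (f : ℂ → ℕ → ℂ) (hf : ∀ a i, rightCoeff q b (z * y) (z * x) i * a ^ i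
      = 1 / qPochInf (b * z * x) q * f a i) (a : ℂ) (ha : ‖a * z * x‖ < 1) :
      Summable (f a) ∧
      HasSum (fun n : ℕ => stieltjesWigert q n x y * rogersSzego q n a b * z ^ n / qPoch q q n)
        (1 / (qPochInf (a * z * x) q * qPochInf (b * z * x) q) * ∑' i : ℕ, f a i) := by
    have ha' : ‖a * (z * x)‖ < 1 := by rwa [← mul_assoc]
    have hf' (i : ℕ) :
        f a i = qPochInf (b * z * x) q * (rightCoeff q b (z * y) (z * x) i * a ^ i) := by
      rw [hf]
      field_simp
    constructor
    · exact ((summable_norm_rightCoeff hq b (z * y) (z * x) a).of_norm.mul_left _).congr fun i => (hf' i).symm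
    · have h := hasSum_generatingFunction (y := y) hq ha' hb'
      simp only [hf, tsum_mul_left] at h
      rw [← mul_assoc, ← mul_assoc] at h
      rwa [one_div_mul_one_div] at h
  refine ⟨fun a ha => main (fun a i => q ^ (i ^ 2) * qPoch (b * z * x) q i / qPoch q q i *
      (a * z * y) ^ i * ramanujanExp q (b * z * q ^ (2 * i) * y)) (fun a i => ?_) a ha,
    fun hq0 h => ?_⟩
  · rw [rightCoeff, ← mul_assoc b z x, show b * (z * y) * q ^ (2 * i) = b * z * q ^ (2 * i) * y by
      ring, mul_assoc a z y, mul_pow a]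
    ring
  have h' : b * (z * y) = 1 := by rwa [← mul_assoc]
  refine ⟨fun a ha => main (fun a i => q ^ (-((i : ℤ) * ((i : ℤ) - 1))) *
      (qPoch (b * z * x) q i / qPoch q q i) *
      (garrettA q (2 * i) / (qPochInf q (q ^ 5) * qPochInf (q ^ 4) (q ^ 5)) -
        garrettB q (2 * i) / (qPochInf (q ^ 2) (q ^ 5) * qPochInf (q ^ 3) (q ^ 5))) *
      (a * z * y) ^ i) (fun a i => ?_) a ha, ?_⟩
  · rw [rightCoeff_of_mul_eq_one hq hq0 h', ← mul_assoc b z x, mul_assoc a z y, mul_pow a]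
    ring
  · refine (hasSum_generatingFunction_X (y := y) hq hb').trans_eq ?_
    rw [← mul_smul_comm, ← mul_smul_comm, ← mul_sub]
    -- Both sides share the factor 1/(zxX;q)_∞, so it suffices to compare the cofactors
    -- coefficientwise.
    refine congrArg (fun F => nhds ((qPochInf ((z * x) • (PowerSeries.X : ℂ⟦X⟧)) q)⁻¹ * F))
      (PowerSeries.ext fun i => ?_)
    rw [map_sub, PowerSeries.coeff_smul, PowerSeries.coeff_smul, PowerSeries.coeff_mk,
      PowerSeries.coeff_mk, PowerSeries.coeff_mk, rightCoeff_of_mul_eq_one hq hq0 h',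
      ← mul_assoc b z x]
    simp only [smul_eq_mul, mul_inv, div_eq_mul_inv]
    ring
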